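/- **Model.** Programs run on a randomized word RAM with words of $w=\Theta(\log n+\log|\Sigma|)$ bits: addition, subtraction, multiplication, division with remainder, comparison, reading a symbol of an input string at a given position, reading or writing a memory cell (initially $0$) at a given address, and drawing a uniformly random word each take one step. Symbols of $\Sigma$ are coded by $1,\dots,|\Sigma|$. For strings $A,B$, $\operatorname{ED}(A,B)$ is the least number of insertions, deletions and substitutions of single symbols that turn $A$ into $B$, and $\log$ is the logarithm to base $2$. **Theorem.** There are a randomized program $\mathsf{Pre}$, a deterministic program $\mathsf{Query}$ and constants $C,c$ such that for every finite alphabet $\Sigma$, all integers $n\ge 2$ and $1\le k\le n$, and all $A,B\in\Sigma^n$ the following hold, where $\mathsf{Pre}$ is given $n,k,|\Sigma|$ and $A$ (but not $B$), and $\mathsf{Query}$ is given $n,k,|\Sigma|$, $A$, $B$ and the memory that $\mathsf{Pre}$ has left: 1. the expected number of steps of $\mathsf{Pre}$ is at most $C\,n\,(\log n)^c$, that is, $\tilde O(n)$; 2. for every outcome of the preprocessing, $\mathsf{Query}$ halts after at most $C\,\frac nk\,(\log n)^c$ steps, that is, in time $\tilde O(n/k)$; 3. with probability at least $1-\frac1n$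 over the random words drawn by $\mathsf{Pre}$ (independently of $B$), $\mathsf{Query}$ answers SMALL if $\operatorname{ED}(A,B)\le \frac{k}{2\log n}$ and LARGE if $\operatorname{ED}(A,B)>40k^2$. -/

import Mathlib

open MeasureTheory
open scoped ENNReal

noncomputable section

/-! ## Randomized word RAM programs with a step count

A program is a fixed finite piece of syntax, independent of the input. All values are words of `w`
bits, that is, natural numbers below `2 ^ w`. There are registers, finitely many of which occur in
a given program, and arrays of words (again, finitely many occur in a program) that are indexed by
words. -/

namespace WordRAM

/-- The binary word operations. -/
inductive Op where
  | add | sub | mul | div | mod | lt | eq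

/-- Arithmetic is modulo `2 ^ w`; subtraction is cut off at `0`; division by `0` gives `0`;
comparisons give `1` for true and `0` for false. -/
def Op.eval (w : ℕ) : Op → ℕ → ℕ → ℕ
  | .add, a, b => (a + b) % 2 ^ w
  | .sub, a, b => a - b
  | .mul, a, b => (a * b) % 2 ^ w
  | .div, a, b => a / b
  | .mod, a, b => a % b
  | .lt, a, b => if a < b then 1 else 0
  | .eq, a, b => if a = b then 1 else 0

/-- Expressions: constants, registers, binary operations, an entry of a work array (the array is
named by a fixed number, the address is computed), an entry of the first or of the second input
string. -/
inductive Expr where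
  | const (c : ℕ)
  | reg (r : ℕ)
  | bin (o : Op) (e₁ e₂ : Expr)
  | load (arr : ℕ) (e : Expr)
  | inA (e : Expr)
  | inB (e : Expr)

/-- Commands. `rand r` puts a fresh uniformly random word into register `r`. -/
inductive Cmd where
  | skip
  | assign (r : ℕ) (e : Expr)
  | store (arr : ℕ) (addr val : Expr)
  | rand (r : ℕ)
  | seq (c₁ c₂ : Cmd)
  | branch (e : Expr) (c₁ c₂ : Cmd)
  | loop (e : Expr) (c : Cmd)

/-- What a program cannot change: the word length, the two read-only input strings, and the tape
from which the random words are taken one after the other. -/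
structure Env where
  w : ℕ
  strA : ℕ → ℕ
  strB : ℕ → ℕ
  tape : ℕ → ℕ

/-- Registers, work arrays, and the number of random words used so far. -/
structure State where
  reg : ℕ → ℕ
  mem : ℕ → ℕ → ℕ
  pos : ℕ

def Expr.eval (E : Env) (s : State) : Expr → ℕ
  | .const c => c % 2 ^ E.w
  | .reg r => s.reg r
  | .bin o e₁ e₂ => o.eval E.w (e₁.eval E s) (e₂.eval E s)
  | .load arr e => s.mem arr (e.eval E s)
  | .inA e => E.strA (e.eval E s)
  | .inB e => E.strB (e.eval E s)

/-- One step for every constant, register access, memory or input access and word operation. -/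
def Expr.cost : Expr → ℕ
  | .const _ => 1
  | .reg _ => 1
  | .bin _ e₁ e₂ => e₁.cost + e₂.cost + 1
  | .load _ e => e.cost + 1
  | .inA e => e.cost + 1
  | .inB e => e.cost + 1

def State.setReg (s : State) (r v : ℕ) : State :=
  { s with reg := Function.update s.reg r v }

def State.setMem (s : State) (arr a v : ℕ) : State :=
  { s with mem := Function.update s.mem arr (Function.update (s.mem arr) a v) }

/-- `Exec E c s s' t`: started in state `s`, the command `c` halts in state `s'` after exactly `t`
steps. A test holds when its value is not `0`. -/
inductive Exec (E : Env) : Cmd → State → State → ℕ → Prop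
  | skip (s : State) : Exec E .skip s s 1
  | assign (s : State) (r : ℕ) (e : Expr) :
      Exec E (.assign r e) s (s.setReg r (e.eval E s)) (e.cost + 1)
  | store (s : State) (arr : ℕ) (addr val : Expr) :
      Exec E (.store arr addr val) s (s.setMem arr (addr.eval E s) (val.eval E s))
        (addr.cost + val.cost + 1)
  | rand (s : State) (r : ℕ) :
      Exec E (.rand r) s { s.setReg r (E.tape s.pos) with pos := s.pos + 1 } 1
  | seq {c₁ c₂ : Cmd} {s s' s'' : State} {t₁ t₂ : ℕ} :
      Exec E c₁ s s' t₁ → Exec E c₂ s' s'' t₂ → Exec E (.seq c₁ c₂) s s'' (t₁ + t₂)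
  | branch_true {e : Expr} {c₁ c₂ : Cmd} {s s' : State} {t : ℕ} :
      e.eval E s ≠ 0 → Exec E c₁ s s' t → Exec E (.branch e c₁ c₂) s s' (e.cost + 1 + t)
  | branch_false {e : Expr} {c₁ c₂ : Cmd} {s s' : State} {t : ℕ} :
      e.eval E s = 0 → Exec E c₂ s s' t → Exec E (.branch e c₁ c₂) s s' (e.cost + 1 + t)
  | loop_true {e : Expr} {c : Cmd} {s s' s'' : State} {t₁ t₂ : ℕ} :
      e.eval E s ≠ 0 → Exec E c s s' t₁ → Exec E (.loop e c) s' s'' t₂ →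
      Exec E (.loop e c) s s'' (e.cost + 1 + t₁ + t₂)
  | loop_false {e : Expr} {c : Cmd} {s : State} :
      e.eval E s = 0 → Exec E (.loop e c) s s (e.cost + 1)

/-- The number of steps of `c` from `s`, equal to `∞` if `c` does not halt. -/
def runtime (E : Env) (c : Cmd) (s : State) : ℝ≥0∞ :=
  ⨅ (s' : State) (t : ℕ) (_ : Exec E c s s' t), (t : ℝ≥0∞)

/-- The program draws no random words. -/
def Cmd.RandFree : Cmd → Prop
  | .skip => True
  | .assign _ _ => True
  | .store _ _ _ => True
  | .rand _ => False
  | .seq c₁ c₂ => c₁.RandFree ∧ c₂.RandFree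
  | .branch _ c₁ c₂ => c₁.RandFree ∧ c₂.RandFree
  | .loop _ c => c.RandFree

/-- Infinite tapes of words of `w` bits. -/
abbrev Tape (w : ℕ) : Type := ℕ → Fin (2 ^ w)

/-- The law of a tape of independent uniformly random words. -/
def tapeMeasure (w : ℕ) : Measure (Tape w) :=
  Measure.infinitePi fun _ : ℕ => (PMF.uniformOfFintype (Fin (2 ^ w))).toMeasure

end WordRAM

/-! ## Gap edit distance with preprocessing of one string -/

namespace GapEdit

open WordRAM

/-- A single edit: an insertion, a deletion or a substitution of one symbol. -/
inductive EditStep {α : Type} : List α → List α → Prop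
  | insert (u v : List α) (a : α) : EditStep (u ++ v) (u ++ a :: v)
  | delete (u v : List α) (a : α) : EditStep (u ++ a :: v) (u ++ v)
  | subst (u v : List α) (a b : α) : EditStep (u ++ a :: v) (u ++ b :: v)

/-- `Edits m x y`: some sequence of exactly `m` edits turns `x` into `y`. -/
inductive Edits {α : Type} : ℕ → List α → List α → Prop
  | refl (x : List α) : Edits 0 x x
  | step {m : ℕ} {x y z : List α} : Edits m x y → EditStep y z → Edits (m + 1) x z

/-- The edit distance: the least number of insertions, deletions and substitutions that turn one
string into the other. -/
def editDist {σ n : ℕ} (A B : Fin n → Fin σ) : ℕ :=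
  sInf {m | Edits m (List.ofFn A) (List.ofFn B)}

/-- A string as it is given to the machine: positions are `0, …, n - 1`, the symbols are coded by
`1, …, σ`, and every position out of range holds `0`. -/
def encode {σ n : ℕ} (A : Fin n → Fin σ) (i : ℕ) : ℕ :=
  if h : i < n then (A ⟨i, h⟩ : ℕ) + 1 else 0

/-- The word length `c₀ · Θ(log n + log σ)`. -/
def wordSize (c₀ n σ : ℕ) : ℕ := c₀ * (Nat.size n + Nat.size σ)

/-- The registers when a program starts: `n`, `k`, `σ`, the largest word, and zeros. -/
def initReg (w n k σ : ℕ) : ℕ → ℕ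
  | 0 => n
  | 1 => k
  | 2 => σ
  | 3 => 2 ^ w - 1
  | _ => 0

/-- While `A` is preprocessed there is no second string. -/
def preEnv {σ n : ℕ} (w : ℕ) (A : Fin n → Fin σ) (ω : Tape w) : Env where
  w := w
  strA := encode A
  strB := fun _ => 0
  tape := fun i => (ω i : ℕ)

/-- The preprocessing starts with empty memory. -/
def preInit (w n k σ : ℕ) : State where
  reg := initReg w n k σ
  mem := fun _ _ => 0
  pos := 0

/-- A query can read both strings. It has no random words. -/
def queryEnv {σ n : ℕ} (w : ℕ) (A B : Fin n → Fin σ) : Env where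
  w := w
  strA := encode A
  strB := encode B
  tape := fun _ => 0

/-- A query starts with the memory that the preprocessing has left, and with fresh registers. -/
def queryInit (w n k σ : ℕ) (s : State) : State where
  reg := initReg w n k σ
  mem := s.mem
  pos := 0

/-- The answer is read from register `0`: the value `1` stands for SMALL, the value `0` for
LARGE. -/
def Correct {σ n : ℕ} (k : ℕ) (A B : Fin n → Fin σ) (s : State) : Prop :=
  ((editDist A B : ℝ) ≤ k / (2 * Real.logb 2 n) → s.reg 0 = 1) ∧
  ((40 * (k : ℝ) ^ 2 < editDist A B) → s.reg 0 = 0)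

end GapEdit

end

/-!
The preprocessing draws `Θ(log n)` random positions in every block of length `k` and builds a
binary tree over the blocks, refined inside the blocks so that its leaves are the samples. For each
of the `2 * s + 1` shifts of `A` by at most `s = ⌊k / (2 * ⌊log n⌋)⌋` it names all nodes of the
tree bottom up: a leaf by the symbol of the shifted string at the sample, an inner node by a
dictionary entry for the node and the names of its children. Two copies of a node have the same
name exactly if the samples below it agree. A query names the nodes for `B` by the same dictionary,
so a node is left without a name exactly if the samples below it agree under no shift. The answer
is SMALL if at most `s * (⌊log n⌋ + 2)` nodes are left without a name, where only blocks and nodes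
above them count.

If at most `s` edits turn `A` into `B`, then outside at most `s` breakpoints `B` is locally a shift
of `A`. Hence every node without a name contains a breakpoint, and each breakpoint lies in only one
node of each of the at most `⌊log n⌋ + 2` levels of the tree.

Conversely, if `z` nodes have no name, the string splits into at most `z + 1` pieces that are
maximal nodes with a name or single blocks. A block costs at most `2 * k` edits. A node under a
shift with more than `k` mismatches is caught by one of its samples with high probability, so a
named node costs at most `k` substitutions and `2 * s` edits for the shift.
-/

namespace WordRAM

/-! ### Runs of programs -/

theorem Exec.deterministic {E : Env} {c : Cmd} {s s₁ s₂ : State} {t₁ t₂ : ℕ}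
    (h₁ : Exec E c s s₁ t₁) (h₂ : Exec E c s s₂ t₂) : s₁ = s₂ ∧ t₁ = t₂ := by
  induction h₁ generalizing s₂ t₂ with
  | skip | assign | store | rand => cases h₂; exact ⟨rfl, rfl⟩
  | seq _ _ ih₁ ih₂ =>
    cases h₂ with
    | seq ha hb =>
      obtain ⟨rfl, rfl⟩ := ih₁ ha
      obtain ⟨rfl, rfl⟩ := ih₂ hb
      exact ⟨rfl, rfl⟩
  | branch_true he _ ih | branch_false he _ ih =>
    cases h₂ with
    | branch_true he' ha | branch_false he' ha =>
      first
      | contradiction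
      | obtain ⟨rfl, rfl⟩ := ih ha
        exact ⟨rfl, rfl⟩
  | loop_true he _ _ ih₁ ih₂ =>
    cases h₂ with
    | loop_true _ ha hb =>
      obtain ⟨rfl, rfl⟩ := ih₁ ha
      obtain ⟨rfl, rfl⟩ := ih₂ hb
      exact ⟨rfl, rfl⟩
    | loop_false he' => contradiction
  | loop_false he =>
    cases h₂ with
    | loop_true he' => contradiction
    | loop_false => exact ⟨rfl, rfl⟩

instance : Add Expr := ⟨.bin .add⟩
instance : Sub Expr := ⟨.bin .sub⟩
instance : Mul Expr := ⟨.bin .mul⟩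
instance : Div Expr := ⟨.bin .div⟩
instance : Mod Expr := ⟨.bin .mod⟩
instance (c : ℕ) : OfNat Expr c := ⟨.const c⟩

/-- Commands one after the other. -/
def block : List Cmd → Cmd
  | [] => .skip
  | c :: cs => .seq c (block cs)

section Expr

variable (E : Env) (s : State) (e e₁ e₂ : Expr) (r a : ℕ)

@[simp] theorem Expr.eval_ofNat : (ofNat(a) : Expr).eval E s = a % 2 ^ E.w := rfl
@[simp] theorem Expr.eval_reg : (Expr.reg r).eval E s = s.reg r := rfl
@[simp] theorem Expr.eval_load : (Expr.load a e).eval E s = s.mem a (e.eval E s) := rfl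
@[simp] theorem Expr.eval_inA : (Expr.inA e).eval E s = E.strA (e.eval E s) := rfl
@[simp] theorem Expr.eval_inB : (Expr.inB e).eval E s = E.strB (e.eval E s) := rfl
@[simp] theorem Expr.eval_add : (e₁ + e₂).eval E s = (e₁.eval E s + e₂.eval E s) % 2 ^ E.w := rfl
@[simp] theorem Expr.eval_sub : (e₁ - e₂).eval E s = e₁.eval E s - e₂.eval E s := rfl
@[simp] theorem Expr.eval_mul : (e₁ * e₂).eval E s = e₁.eval E s * e₂.eval E s % 2 ^ E.w := rfl
@[simp] theorem Expr.eval_div : (e₁ / e₂).eval E s = e₁.eval E s / e₂.eval E s := rfl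
@[simp] theorem Expr.eval_mod : (e₁ % e₂).eval E s = e₁.eval E s % e₂.eval E s := rfl
@[simp] theorem Expr.eval_lt :
    (Expr.bin .lt e₁ e₂).eval E s = if e₁.eval E s < e₂.eval E s then 1 else 0 := rfl
@[simp] theorem Expr.eval_eq :
    (Expr.bin .eq e₁ e₂).eval E s = if e₁.eval E s = e₂.eval E s then 1 else 0 := rfl

@[simp] theorem Expr.cost_add : (e₁ + e₂).cost = e₁.cost + e₂.cost + 1 := rfl
@[simp] theorem Expr.cost_sub : (e₁ - e₂).cost = e₁.cost + e₂.cost + 1 := rfl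
@[simp] theorem Expr.cost_div : (e₁ / e₂).cost = e₁.cost + e₂.cost + 1 := rfl

end Expr

section State

variable (s : State) (r v x a i b : ℕ)

@[simp] theorem State.setReg_reg : (s.setReg r v).reg x = if x = r then v else s.reg x :=
  Function.update_apply ..

@[simp] theorem State.setReg_mem : (s.setReg r v).mem = s.mem := rfl

@[simp] theorem State.setReg_pos : (s.setReg r v).pos = s.pos := rfl

@[simp] theorem State.setMem_reg : (s.setMem a i v).reg = s.reg := rfl

@[simp] theorem State.setMem_pos : (s.setMem a i v).pos = s.pos := rfl

@[simp] theorem State.setMem_mem :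
    (s.setMem a i v).mem b = if b = a then Function.update (s.mem a) i v else s.mem b :=
  Function.update_apply ..

end State

/-- From `s`, the command `c` halts within `b` steps in a state that satisfies `Q`. -/
def Runs (E : Env) (c : Cmd) (s : State) (b : ℕ) (Q : State → Prop) : Prop :=
  ∃ (s' : State) (t : ℕ), Exec E c s s' t ∧ t ≤ b ∧ Q s'

namespace Runs

variable {E : Env} {s : State} {Q R : State → Prop} {b b' b₁ b₂ : ℕ}

theorem imp {c : Cmd} (h : Runs E c s b R) (hQ : ∀ s', R s' → Q s') : Runs E c s b Q := by
  obtain ⟨s', t, he, ht, hr⟩ := h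
  exact ⟨s', t, he, ht, hQ _ hr⟩

theorem of_le {c : Cmd} (h : Runs E c s b Q) (hb : b ≤ b') : Runs E c s b' Q := by
  obtain ⟨s', t, he, ht, hq⟩ := h
  exact ⟨s', t, he, ht.trans hb, hq⟩

theorem skip (h : Q s) : Runs E .skip s 1 Q := ⟨_, _, .skip s, le_rfl, h⟩

theorem assign {r : ℕ} {e : Expr} (v : ℕ) (hv : e.eval E s = v) (h : Q (s.setReg r v)) :
    Runs E (.assign r e) s (e.cost + 1) Q := ⟨_, _, .assign s r e, le_rfl, by rwa [hv]⟩

theorem store {arr : ℕ} {a e : Expr} (x v : ℕ) (hx : a.eval E s = x) (hv : e.eval E s = v)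
    (h : Q (s.setMem arr x v)) : Runs E (.store arr a e) s (a.cost + e.cost + 1) Q :=
  ⟨_, _, .store s arr a e, le_rfl, by rwa [hx, hv]⟩

theorem rand {r : ℕ} (h : Q { s.setReg r (E.tape s.pos) with pos := s.pos + 1 }) :
    Runs E (.rand r) s 1 Q := ⟨_, _, .rand s r, le_rfl, h⟩

theorem cons {c : Cmd} {cs : List Cmd} (h : Runs E c s b fun s' => Runs E (block cs) s' b' Q) :
    Runs E (block (c :: cs)) s (b + b') Q := by
  obtain ⟨s', t, he, ht, s'', t', he', ht', hq⟩ := h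
  exact ⟨s'', t + t', he.seq he', add_le_add ht ht', hq⟩

theorem nil (h : Q s) : Runs E (block []) s 1 Q := skip h

theorem branch {e : Expr} {c₁ c₂ : Cmd} (h₁ : e.eval E s ≠ 0 → Runs E c₁ s b₁ Q)
    (h₂ : e.eval E s = 0 → Runs E c₂ s b₂ Q) :
    Runs E (.branch e c₁ c₂) s (e.cost + 1 + max b₁ b₂) Q := by
  by_cases h : e.eval E s = 0
  · obtain ⟨s', t, he, ht, hq⟩ := h₂ h
    exact ⟨s', _, .branch_false h he, by omega, hq⟩
  · obtain ⟨s', t, he, ht, hq⟩ := h₁ h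
    exact ⟨s', _, .branch_true h he, by omega, hq⟩

/-- `I m` is the invariant when `m` iterations are still to come. -/
theorem loop {e : Expr} {c : Cmd} (I : ℕ → State → Prop)
    (hstep : ∀ m s, I (m + 1) s → e.eval E s ≠ 0 ∧ Runs E c s b (I m))
    (hend : ∀ s, I 0 s → e.eval E s = 0) (m : ℕ) (h : I m s) :
    Runs E (.loop e c) s (m * (e.cost + 1 + b) + (e.cost + 1)) (I 0) := by
  induction m generalizing s with
  | zero => exact ⟨s, _, .loop_false (hend s h), by omega, h⟩
  | succ m ih =>
    obtain ⟨hne, s', t, he, ht, hi⟩ := hstep m s h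
    obtain ⟨s'', t', he', ht', hi'⟩ := ih hi
    refine ⟨s'', _, .loop_true hne he he', ?_, hi'⟩
    rw [Nat.succ_mul]
    omega

theorem runtime_le {c : Cmd} (h : Runs E c s b Q) : runtime E c s ≤ b := by
  obtain ⟨s', t, he, ht, -⟩ := h
  exact iInf_le_of_le s' <| iInf_le_of_le t <| iInf_le_of_le he <| mod_cast ht

theorem post_of_exec {c : Cmd} {s' : State} {t : ℕ} (h : Runs E c s b Q) (he : Exec E c s s' t) :
    Q s' := by
  obtain ⟨s'', t', he', -, hq⟩ := h
  rwa [(he.deterministic he').1]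

end Runs

end WordRAM

namespace GapEdit

variable {α : Type}

/-! ### Edit sequences -/

theorem Edits.trans {m m' : ℕ} {x y z : List α} (h : Edits m x y) (h' : Edits m' y z) :
    Edits (m + m') x z := by
  induction h' with
  | refl _ => exact h
  | step _ hs ih => exact (ih h).step hs

theorem EditStep.append_left {x y : List α} (h : EditStep x y) (l : List α) :
    EditStep (l ++ x) (l ++ y) := by
  cases h with
  | insert u v a => simpa using EditStep.insert (l ++ u) v a
  | delete u v a => simpa using EditStep.delete (l ++ u) v a
  | subst u v a b => simpa using EditStep.subst (l ++ u) v a b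

theorem EditStep.append_right {x y : List α} (h : EditStep x y) (l : List α) :
    EditStep (x ++ l) (y ++ l) := by
  cases h with
  | insert u v a => simpa using EditStep.insert u (v ++ l) a
  | delete u v a => simpa using EditStep.delete u (v ++ l) a
  | subst u v a b => simpa using EditStep.subst u (v ++ l) a b

theorem Edits.append {m m' : ℕ} {x y x' y' : List α} (h : Edits m x y) (h' : Edits m' x' y') :
    Edits (m + m') (x ++ x') (y ++ y') := by
  have right : Edits m' (y ++ x') (y ++ y') := by
    clear h
    induction h' with
    | refl _ => exact .refl _
    | step _ hs ih => exact ih.step (hs.append_left y)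
  refine Edits.trans ?_ right
  clear right h'
  induction h with
  | refl _ => exact .refl _
  | step _ hs ih => exact ih.step (hs.append_right x')

theorem edits_nil_right (u : List α) : Edits u.length u [] := by
  induction u with
  | nil => exact .refl _
  | cons a u ih =>
    have h : Edits 1 (a :: u) u := (Edits.refl (a :: u)).step (EditStep.delete [] u a)
    simpa [add_comm] using h.trans ih

theorem edits_nil_left (u : List α) : Edits u.length [] u := by
  induction u with
  | nil => exact .refl _
  | cons a u ih => exact ih.step (EditStep.insert [] u a)

/-- At most `c` edits turn `x` into `y`. -/
def EditsWithin (c : ℕ) (x y : List α) : Prop := ∃ r ≤ c, Edits r x y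

theorem EditsWithin.mono {c c' : ℕ} {x y : List α} (h : EditsWithin c x y) (hc : c ≤ c') :
    EditsWithin c' x y :=
  let ⟨r, hr, he⟩ := h
  ⟨r, hr.trans hc, he⟩

theorem EditsWithin.append {c c' : ℕ} {x y x' y' : List α} (h : EditsWithin c x y)
    (h' : EditsWithin c' x' y') : EditsWithin (c + c') (x ++ x') (y ++ y') :=
  let ⟨r, hr, he⟩ := h
  let ⟨r', hr', he'⟩ := h'
  ⟨r + r', add_le_add hr hr', he.append he'⟩

theorem editsWithin_refl (x : List α) : EditsWithin 0 x x := ⟨0, le_rfl, .refl x⟩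

theorem editsWithin_length_add_length (x y : List α) : EditsWithin (x.length + y.length) x y :=
  ⟨_, le_rfl, (edits_nil_right x).trans (edits_nil_left y)⟩

theorem edits_editDist {σ n : ℕ} (A B : Fin n → Fin σ) :
    Edits (editDist A B) (List.ofFn A) (List.ofFn B) :=
  let ⟨r, _, h⟩ := editsWithin_length_add_length (List.ofFn A) (List.ofFn B)
  Nat.sInf_mem (s := {m | Edits m (List.ofFn A) (List.ofFn B)}) ⟨r, h⟩

theorem editDist_le {σ n c : ℕ} {A B : Fin n → Fin σ}
    (h : EditsWithin c (List.ofFn A) (List.ofFn B)) : editDist A B ≤ c :=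
  let ⟨_, hr, he⟩ := h
  (Nat.sInf_le he).trans hr

/-! ### Substrings under a shift -/

/-- The substring of `f` of length `m` that starts at position `a`. -/
def seg (f : ℕ → α) (a m : ℕ) : List α := (List.range' a m).map f

theorem seg_add (f : ℕ → α) (a m m' : ℕ) : seg f a (m + m') = seg f a m ++ seg f (a + m) m' := by
  simp [seg, ← List.map_append]

@[simp] theorem length_seg (f : ℕ → α) (a m : ℕ) : (seg f a m).length = m := by simp [seg]

theorem editsWithin_seg_of_eq_off {f g : ℕ → α} {a b m : ℕ} {S : Finset ℕ}
    (h : ∀ i < m, b + i ∉ S → f (a + i) = g (b + i)) :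
    EditsWithin S.card (seg f a m) (seg g b m) := by
  suffices EditsWithin (S.filter (· < b + m)).card (seg f a m) (seg g b m) from
    this.mono (Finset.card_filter_le _ _)
  induction m with
  | zero => exact (editsWithin_refl _).mono (Nat.zero_le _)
  | succ m ih =>
    have hprefix := ih fun i hi => h i (by omega)
    rw [seg_add, seg_add]
    by_cases hS : b + m ∈ S
    · have hlast : EditsWithin 1 (seg f (a + m) 1) (seg g (b + m) 1) :=
        ⟨1, le_rfl, (Edits.refl _).step (EditStep.subst [] [] (f (a + m)) (g (b + m)))⟩
      refine (hprefix.append hlast).mono (Finset.card_lt_card ?_)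
      refine Finset.ssubset_iff.2 ⟨b + m, by simp, Finset.insert_subset (by simp [hS]) ?_⟩
      exact Finset.monotone_filter_right S fun i _ hi => by omega
    · have hlast : seg f (a + m) 1 = seg g (b + m) 1 := by simp [seg, h m (by omega) hS]
      rw [hlast]
      exact (hprefix.append (editsWithin_refl _)).mono
        (Finset.card_le_card (Finset.monotone_filter_right S fun i _ hi => by omega))

/-- Deleting at one end, inserting at the other and substituting in `S` realizes the shift `d - s`;
where the shift leaves the substring nothing is assumed. -/
theorem editsWithin_seg_of_shift {f g : ℕ → α} {a m s d : ℕ} {S : Finset ℕ} (hd : d ≤ 2 * s)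
    (h : ∀ p, a ≤ p → p < a + m → s ≤ p + d → p + d - s < a + m → p ∉ S → f (p + d - s) = g p) :
    EditsWithin (S.card + 2 * s) (seg f a m) (seg g a m) := by
  rcases le_total m s with hm | hm
  · exact (editsWithin_length_add_length _ _).mono (by simp only [length_seg]; omega)
  have delete_seg (b e : ℕ) : EditsWithin e (seg f b e) [] :=
    ⟨e, le_rfl, by simpa using edits_nil_right (seg f b e)⟩
  have insert_seg (b e : ℕ) : EditsWithin e [] (seg g b e) :=
    ⟨e, le_rfl, by simpa using edits_nil_left (seg g b e)⟩
  rcases le_total s d with hsd | hsd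
  · obtain ⟨e, rfl⟩ := Nat.exists_eq_add_of_le hsd
    obtain ⟨m, rfl⟩ := Nat.exists_eq_add_of_le (show e ≤ m by omega)
    have hmid : EditsWithin S.card (seg f (a + e) m) (seg g a m) :=
      editsWithin_seg_of_eq_off fun i hi hiS => by
        have := h (a + i) (by omega) (by omega) (by omega) (by omega) hiS
        rwa [show a + i + (s + e) - s = a + e + i by omega] at this
    have := ((delete_seg a e).append hmid).append (insert_seg (a + m) e)
    rw [List.append_nil, List.nil_append, ← seg_add, ← seg_add, add_comm m e] at this
    exact this.mono (by omega)
  · obtain ⟨e, rfl⟩ := Nat.exists_eq_add_of_le hsd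
    obtain ⟨m, rfl⟩ := Nat.exists_eq_add_of_le (show e ≤ m by omega)
    have hmid : EditsWithin S.card (seg f a m) (seg g (a + e) m) :=
      editsWithin_seg_of_eq_off fun i hi hiS => by
        have := h (a + e + i) (by omega) (by omega) (by omega) (by omega) hiS
        rwa [show a + e + i + d - (d + e) = a + i by omega] at this
    have := ((insert_seg a e).append hmid).append (delete_seg (a + m) e)
    rw [List.append_nil, List.nil_append, ← seg_add, ← seg_add, add_comm m e] at this
    exact this.mono (by omega)

/-- On the positions `a ≤ p < b`, the string `y` is the copy of `x` that is shifted by `δ`. -/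
def ShiftedOn (x y : List α) (δ : ℤ) (a b : ℕ) : Prop :=
  ∀ p, a ≤ p → p < b → 0 ≤ (p : ℤ) + δ ∧ x[((p : ℤ) + δ).toNat]? = y[p]?

theorem ShiftedOn.trans {x y z : List α} {δ ε : ℤ} {a b a' b' : ℕ} (h : ShiftedOn x y δ a' b')
    (h' : ShiftedOn y z ε a b) (ha : (a' : ℤ) ≤ a + ε) (hb : (b : ℤ) + ε ≤ b') :
    ShiftedOn x z (δ + ε) a b := by
  intro p hap hpb
  obtain ⟨hp, hyz⟩ := h' p hap hpb
  obtain ⟨hp', hxy⟩ := h ((p : ℤ) + ε).toNat (by omega) (by omega)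
  rw [Int.toNat_of_nonneg hp] at hp' hxy
  rw [add_comm δ, ← add_assoc, ← hyz]
  exact ⟨hp', hxy⟩

theorem EditStep.exists_shiftedOn {y z : List α} (h : EditStep y z) :
    ∃ (u : ℕ) (ε : ℤ), |ε| ≤ 1 ∧ (∀ a b, b ≤ u → ShiftedOn y z 0 a b) ∧
      ∀ a b, u < a → ShiftedOn y z ε a b := by
  have prefix_eq (u v v' : List α) (a b : ℕ) (hb : b ≤ u.length) :
      ShiftedOn (u ++ v) (u ++ v') 0 a b := fun p _ hp => by
    simp [List.getElem?_append, hp.trans_le hb]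
  cases h with
  | insert u v c =>
    refine ⟨u.length, -1, by simp, prefix_eq u _ _, fun a b ha p hap _ => ⟨by omega, ?_⟩⟩
    obtain ⟨q, rfl⟩ := Nat.exists_eq_add_of_lt (ha.trans_le hap)
    rw [show (((u.length + q + 1 : ℕ) : ℤ) + -1).toNat = u.length + q by omega]
    simp [List.getElem?_append, add_assoc]
  | delete u v c =>
    refine ⟨u.length, 1, by simp, prefix_eq u _ _, fun a b ha p hap _ => ⟨by omega, ?_⟩⟩
    obtain ⟨q, rfl⟩ := Nat.exists_eq_add_of_lt (ha.trans_le hap)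
    rw [show (((u.length + q + 1 : ℕ) : ℤ) + 1).toNat = u.length + (q + 1 + 1) by omega]
    simp [List.getElem?_append, add_assoc]
  | subst u v c c' =>
    refine ⟨u.length, 0, by simp, prefix_eq u _ _, fun a b ha p hap _ => ⟨by omega, ?_⟩⟩
    obtain ⟨q, rfl⟩ := Nat.exists_eq_add_of_lt (ha.trans_le hap)
    rw [add_zero, Int.toNat_natCast]
    simp [List.getElem?_append, add_assoc]

theorem Edits.exists_breakpoints {m : ℕ} {x y : List α} (h : Edits m x y) :
    ∃ S : Finset ℕ, S.card ≤ m ∧ ∀ a b : ℕ, (∀ p, a ≤ p → p < b → p ∉ S) →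
      ∃ δ : ℤ, |δ| ≤ m ∧ ShiftedOn x y δ a b := by
  induction h with
  | refl x => exact ⟨∅, by simp, fun a b _ => ⟨0, by simp, fun p _ _ => by simp⟩⟩
  | @step m x y z _ hs ih =>
    obtain ⟨S, hS, hshift⟩ := ih
    obtain ⟨u, ε, hε, hbefore, hafter⟩ := hs.exists_shiftedOn
    rw [abs_le] at hε
    -- The breakpoints of `y`, moved to their positions in `z`.
    let S' := S.image fun q => if q < u then q else ((q : ℤ) - ε).toNat
    have mem_S' (q : ℕ) (hq : q ∈ S) : (if q < u then q else ((q : ℤ) - ε).toNat) ∈ S' :=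
      Finset.mem_image_of_mem _ hq
    refine ⟨insert u S', (Finset.card_insert_le _ _).trans
      (Nat.succ_le_succ (Finset.card_image_le.trans hS)), fun a b hab => ?_⟩
    rcases le_or_gt b a with hba | hba
    · exact ⟨0, by rw [abs_zero]; positivity, fun p _ _ => by omega⟩
    have hu : b ≤ u ∨ u < a := by
      by_contra! hu
      exact hab u hu.2 hu.1 (Finset.mem_insert_self _ _)
    rcases hu with hu | hu
    · obtain ⟨δ, hδ, hxy⟩ := hshift a b fun p hap hpb hpS => hab p hap hpb
        (Finset.mem_insert_of_mem (by simpa [show p < u by omega] using mem_S' p hpS))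
      rw [abs_le] at hδ
      exact ⟨δ + 0, by rw [abs_le]; push_cast; omega,
        hxy.trans (hbefore a b hu) (by omega) (by omega)⟩
    · obtain ⟨δ, hδ, hxy⟩ := hshift ((a : ℤ) + ε).toNat ((b : ℤ) + ε).toNat fun p hap hpb hpS => by
        refine hab ((p : ℤ) - ε).toNat (by omega) (by omega) (Finset.mem_insert_of_mem ?_)
        simpa [show ¬p < u by omega] using mem_S' p hpS
      rw [abs_le] at hδ
      exact ⟨δ + ε, by rw [abs_le]; push_cast; omega,
        hxy.trans (hafter a b hu) (by omega) (by omega)⟩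

end GapEdit

namespace GapEdit

/-! ### Heap-ordered binary trees -/

/-- The `r`-th generation below node `i`, where the children of `i` are `2 * i` and
`2 * i + 1`. -/
def descendants (r i : ℕ) : Finset ℕ := Finset.Ico (i * 2 ^ r) ((i + 1) * 2 ^ r)

/-- Node `i` has height `R` in the tree with root `1` and the leaves `M, …, 2 * M - 1`. -/
structure HasHeight (M R i : ℕ) : Prop where
  le : M ≤ i * 2 ^ R
  lt : (i + 1) * 2 ^ R ≤ 2 * M

section Tree

variable {M N R r i : ℕ}

theorem mem_descendants {y : ℕ} : y ∈ descendants r i ↔ i * 2 ^ r ≤ y ∧ y < (i + 1) * 2 ^ r :=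
  Finset.mem_Ico

@[simp] theorem descendants_zero : descendants 0 i = {i} := by simp [descendants]

theorem disjoint_descendants_children :
    Disjoint (descendants r (2 * i)) (descendants r (2 * i + 1)) :=
  Finset.Ico_disjoint_Ico_consecutive ..

theorem descendants_succ :
    descendants (r + 1) i = descendants r (2 * i) ∪ descendants r (2 * i + 1) := by
  rw [descendants, descendants, descendants, Finset.Ico_union_Ico_eq_Ico
    (Nat.mul_le_mul_right _ (by omega)) (Nat.mul_le_mul_right _ (by omega))]
  congr 1 <;> ring

namespace HasHeight

theorem pos (hi : HasHeight M R i) : 1 ≤ i := by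
  by_contra! h
  obtain rfl : i = 0 := by omega
  have := hi.le
  have := hi.lt
  have := Nat.one_le_two_pow (n := R)
  omega

theorem lt_two_mul (hi : HasHeight M R i) : i < 2 * M :=
  (Nat.lt_succ_self i).trans_le ((Nat.le_mul_of_pos_right _ (by positivity)).trans hi.lt)

theorem left (hi : HasHeight M (R + 1) i) : HasHeight M R (2 * i) where
  le := hi.le.trans_eq (by ring)
  lt := (Nat.mul_le_mul_right (2 ^ R) (by omega : 2 * i + 1 ≤ (i + 1) * 2)).trans
    ((by ring : _ = (i + 1) * 2 ^ (R + 1)).trans_le hi.lt)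

theorem right (hi : HasHeight M (R + 1) i) : HasHeight M R (2 * i + 1) where
  le := (hi.le.trans_eq (by ring : _ = 2 * i * 2 ^ R)).trans (Nat.mul_le_mul_right _ (by omega))
  lt := (by ring : _ = (i + 1) * 2 ^ (R + 1)).trans_le hi.lt

theorem lt_leaves (hi : HasHeight M (R + 1) i) : i < M := by
  have := hi.right.lt_two_mul
  omega

theorem mul_two_pow (hi : HasHeight M R i) (t : ℕ) : HasHeight (M * 2 ^ t) (R + t) i where
  le := by simpa only [pow_add, mul_assoc] using Nat.mul_le_mul_right (2 ^ t) hi.le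
  lt := by simpa only [pow_add, mul_assoc] using Nat.mul_le_mul_right (2 ^ t) hi.lt

end HasHeight

end Tree

/-! ### Naming the nodes of several copies of a tree -/

/-- The address in the dictionary for the node `i` whose children have the names `l` and `r`; all
names are less than `X`. -/
def pairKey (X i l r : ℕ) : ℕ := (i * X + l) * X + r

theorem mul_add_div_of_lt {i d D : ℕ} (hd : d < D) : (i * D + d) / D = i := by
  rw [mul_comm, Nat.mul_add_div (by omega), Nat.div_eq_of_lt hd, add_zero]

theorem mul_add_lt_mul {i d D N : ℕ} (hi : i < N) (hd : d < D) : i * D + d < N * D :=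
  (Nat.div_lt_iff_lt_mul (by omega)).1 (by rwa [mul_add_div_of_lt hd])

theorem pairKey_inj {X i l r i' l' r' : ℕ} (hl : l < X) (hr : r < X) (hl' : l' < X)
    (hr' : r' < X) : pairKey X i l r = pairKey X i' l' r' ↔ i = i' ∧ l = l' ∧ r = r' := by
  have split {a b a' b' : ℕ} (hb : b < X) (hb' : b' < X) (h : a * X + b = a' * X + b') :
      a = a' ∧ b = b' :=
    ⟨by simpa only [mul_add_div_of_lt hb, mul_add_div_of_lt hb'] using congrArg (· / X) h,
      by simpa only [Nat.mul_add_mod_of_lt hb, Nat.mul_add_mod_of_lt hb'] using congrArg (· % X) h⟩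
  refine ⟨fun h => ?_, by rintro ⟨rfl, rfl, rfl⟩; rfl⟩
  obtain ⟨hpair, hr⟩ := split hr hr' h
  obtain ⟨hi, hl⟩ := split hl hl' hpair
  exact ⟨hi, hl, hr⟩

theorem pairKey_lt {X M i l r : ℕ} (hi : i < M) (hl : l < X) (hr : r < X) :
    pairKey X i l r < M * X * X :=
  mul_add_lt_mul (mul_add_lt_mul hi hl) hr

/-- The dictionary address for the node of number `y`, where node `i` in copy `d` of the tree has
the number `i * D + d`, and `cur` gives the names of the nodes by their numbers. -/
def slot (X D : ℕ) (cur : ℕ → ℕ) (y : ℕ) : ℕ :=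
  pairKey X (y / D) (cur (2 * (y / D) * D + y % D)) (cur ((2 * (y / D) + 1) * D + y % D))

/-- The state of the naming when the nodes of number at least `z` have a name: `cur` gives the
names, `tab` is the dictionary (`0` for no entry), `cnt` the last name in use. There are `D` copies
of the tree with the leaves `M, …, 2 * M - 1`; the name of leaf `i` in copy `d` is `leaf d i`. -/
structure Naming (leaf : ℕ → ℕ → ℕ) (M D X : ℕ) (tab cur : ℕ → ℕ) (cnt z : ℕ) : Prop where
  cur_leaf : ∀ y, z ≤ y → M ≤ y / D → y / D < 2 * M → cur y = leaf (y % D) (y / D)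
  cur_node : ∀ y, z ≤ y → y / D < M → tab (slot X D cur y) = cur y
  cur_ne : ∀ y, z ≤ y → y / D < 2 * M → cur y ≠ 0
  cur_lt : ∀ y, z ≤ y → y / D < 2 * M → cur y < X
  tab_ne : ∀ a, tab a ≠ 0 → ∃ y, z ≤ y ∧ y / D < M ∧ a = slot X D cur y
  tab_inj : ∀ a a', tab a ≠ 0 → tab a = tab a' → a = a'
  tab_le : ∀ a, tab a ≤ cnt
  cnt_le : cnt + z ≤ 2 * M * D

section Naming

variable {leaf : ℕ → ℕ → ℕ} {M D X i d z : ℕ} {tab cur : ℕ → ℕ} {cnt : ℕ}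

theorem slot_mul_add (hd : d < D) : slot X D cur (i * D + d) =
    pairKey X i (cur (2 * i * D + d)) (cur ((2 * i + 1) * D + d)) := by
  rw [slot, mul_add_div_of_lt hd, Nat.mul_add_mod_of_lt hd]

theorem slot_update {y v : ℕ} (hD : 0 < D) (hz : D ≤ z) (hy : z ≤ y) :
    slot X D (Function.update cur z v) y = slot X D cur y := by
  have hy0 : 1 ≤ y / D := (Nat.one_le_div_iff hD).2 (hz.trans hy)
  have hsplit := Nat.div_add_mod y D
  rw [slot, Function.update_of_ne (by nlinarith), Function.update_of_ne (by nlinarith), slot]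

theorem naming_start (hD : 0 < D) : Naming leaf M D X (fun _ => 0) cur 0 (2 * M * D) := by
  have le_div (y : ℕ) (hy : 2 * M * D ≤ y) : 2 * M ≤ y / D := (Nat.le_div_iff_mul_le hD).2 hy
  constructor
  case cur_leaf | cur_ne | cur_lt => intro y hy; have := le_div y hy; omega
  case cur_node => intro y hy; have := le_div y hy; omega
  case cnt_le => omega
  all_goals simp

theorem forall_le_update {P : ℕ → ℕ → Prop} {v : ℕ} (hz : P z v)
    (h : ∀ y, z + 1 ≤ y → P y (cur y)) : ∀ y, z ≤ y → P y (Function.update cur z v y) := by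
  intro y hy
  rcases hy.eq_or_lt with rfl | hlt
  · rwa [Function.update_self]
  · rw [Function.update_of_ne hlt.ne']
    exact h y hlt

theorem Naming.step {tab' : ℕ → ℕ} {cnt' v : ℕ} (hN : Naming leaf M D X tab cur cnt (z + 1))
    (hD : 0 < D) (hz : D ≤ z) (hv : v ≠ 0) (hvX : v < X)
    (hleaf : M ≤ z / D → v = leaf (z % D) (z / D))
    (hnode : z / D < M → tab' (slot X D cur z) = v) (htab : ∀ a, tab a ≠ 0 → tab' a = tab a)
    (htab' : ∀ a, tab' a ≠ 0 → tab a ≠ 0 ∨ z / D < M ∧ a = slot X D cur z)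
    (hinj : ∀ a a', tab' a ≠ 0 → tab' a = tab' a' → a = a') (hle : ∀ a, tab' a ≤ cnt')
    (hcnt : cnt' ≤ cnt + 1) : Naming leaf M D X tab' (Function.update cur z v) cnt' z where
  cur_leaf := forall_le_update (P := fun y c => M ≤ y / D → y / D < 2 * M → c = leaf _ _)
    (fun h _ => hleaf h) hN.cur_leaf
  cur_node y hy := by
    rw [slot_update hD hz hy]
    refine forall_le_update (P := fun y c => y / D < M → tab' (slot X D cur y) = c) hnode
      (fun y hy hyM => ?_) y hy
    rw [← hN.cur_node y hy hyM]
    exact htab _ (hN.cur_node y hy hyM ▸ hN.cur_ne y hy (by omega))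
  cur_ne := forall_le_update (P := fun y c => y / D < 2 * M → c ≠ 0) (fun _ => hv) hN.cur_ne
  cur_lt := forall_le_update (P := fun y c => y / D < 2 * M → c < X) (fun _ => hvX) hN.cur_lt
  tab_ne a ha := by
    rcases htab' a ha with ha | ⟨hzM, rfl⟩
    · obtain ⟨y, hy, hyM, rfl⟩ := hN.tab_ne a ha
      exact ⟨y, by omega, hyM, (slot_update hD hz (by omega)).symm⟩
    · exact ⟨z, le_rfl, hzM, (slot_update hD hz le_rfl).symm⟩
  tab_inj := hinj
  tab_le := hle
  cnt_le := by have := hN.cnt_le; omega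

theorem Naming.step_leaf (hN : Naming leaf M D X tab cur cnt (z + 1)) (hD : 0 < D) (hz : D ≤ z)
    (hzM : M ≤ z / D) (h0 : leaf (z % D) (z / D) ≠ 0) (hX : leaf (z % D) (z / D) < X) :
    Naming leaf M D X tab (Function.update cur z (leaf (z % D) (z / D))) cnt z :=
  hN.step hD hz h0 hX (fun _ => rfl) (fun h => absurd hzM h.not_ge) (fun _ _ => rfl)
    (fun _ => .inl) hN.tab_inj hN.tab_le (Nat.le_succ _)

theorem Naming.tab_lt (hN : Naming leaf M D X tab cur cnt z) (hX : 2 * M * D < X) (a : ℕ) :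
    tab a < X := by
  have := hN.tab_le a
  have := hN.cnt_le
  omega

theorem Naming.step_old (hN : Naming leaf M D X tab cur cnt (z + 1)) (hD : 0 < D) (hz : D ≤ z)
    (hzM : z / D < M) (hX : 2 * M * D < X) (h0 : tab (slot X D cur z) ≠ 0) :
    Naming leaf M D X tab (Function.update cur z (tab (slot X D cur z))) cnt z :=
  hN.step hD hz h0 (hN.tab_lt hX _) (fun h => absurd hzM h.not_gt) (fun _ => rfl) (fun _ _ => rfl)
    (fun _ => .inl) hN.tab_inj hN.tab_le (Nat.le_succ _)

theorem Naming.step_new (hN : Naming leaf M D X tab cur cnt (z + 1)) (hD : 0 < D) (hz : D ≤ z)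
    (hzM : z / D < M) (hX : 2 * M * D < X) (h0 : tab (slot X D cur z) = 0) :
    Naming leaf M D X (Function.update tab (slot X D cur z) (cnt + 1))
      (Function.update cur z (cnt + 1)) (cnt + 1) z := by
  have hcnt := hN.cnt_le
  have hle := hN.tab_le
  refine hN.step hD hz (Nat.succ_ne_zero _) (by omega) (fun h => absurd hzM h.not_gt)
    (fun _ => Function.update_self ..) (fun a ha => ?_) (fun a ha => ?_) (fun a a' ha haa' => ?_)
    (fun a => ?_) le_rfl
  · exact Function.update_of_ne (by rintro rfl; exact ha h0) ..
  · by_cases h : a = slot X D cur z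
    · exact .inr ⟨hzM, h⟩
    · exact .inl (by rwa [Function.update_of_ne h] at ha)
  · simp only [Function.update_apply] at ha haa'
    split_ifs at ha haa' with h h' h'
    · rw [h, h']
    · have := hle a'; omega
    · have := hle a; omega
    · exact hN.tab_inj a a' ha haa'
  · rw [Function.update_apply]
    have := hle a
    split_ifs <;> omega

/-! ### Looking up the nodes of a further tree -/

/-- `c` gives the names in `tab` of the nodes `z, …, 2 * M - 1` of a tree with the leaf names `bl`,
and `0` for the nodes that have no name there. -/
structure Lookup (bl : ℕ → ℕ) (M X : ℕ) (tab c : ℕ → ℕ) (z : ℕ) : Prop where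
  leaf : ∀ i, z ≤ i → M ≤ i → i < 2 * M → c i = bl i
  node : ∀ i, z ≤ i → i < M → c i = tab (pairKey X i (c (2 * i)) (c (2 * i + 1)))

variable {bl c : ℕ → ℕ}

theorem Lookup.lt (hL : Lookup bl M X tab c z) (hbl : ∀ i, bl i < X) (htab : ∀ a, tab a < X)
    (hi : z ≤ i) (hi' : i < 2 * M) : c i < X := by
  rcases lt_or_ge i M with h | h
  · rw [hL.node i hi h]
    exact htab _
  · rw [hL.leaf i hi h hi']
    exact hbl i

theorem Lookup.step {v : ℕ} (hL : Lookup bl M X tab c (z + 1)) (hz : 1 ≤ z)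
    (hleaf : M ≤ z → v = bl z)
    (hnode : z < M → v = tab (pairKey X z (c (2 * z)) (c (2 * z + 1)))) :
    Lookup bl M X tab (Function.update c z v) z where
  leaf := forall_le_update (P := fun i c => M ≤ i → i < 2 * M → c = bl i) (fun h _ => hleaf h)
    hL.leaf
  node i hi hiM := by
    rw [Function.update_of_ne (by omega : 2 * i ≠ z),
      Function.update_of_ne (by omega : 2 * i + 1 ≠ z)]
    exact forall_le_update
      (P := fun i v => i < M → v = tab (pairKey X i (c (2 * i)) (c (2 * i + 1))))
      hnode hL.node i hi hiM

theorem Naming.lookup_eq_iff {R : ℕ} (hN : Naming leaf M D X tab cur cnt D)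
    (hL : Lookup bl M X tab c 1) (hX : 2 * M * D < X) (hbl : ∀ i, bl i < X)
    (hi : HasHeight M R i) (hd : d < D) :
    c i = cur (i * D + d) ↔ ∀ y ∈ descendants R i, leaf d y = bl y := by
  have le_number {j : ℕ} (hj : 1 ≤ j) : D ≤ j * D + d :=
    Nat.le_add_right_of_le (Nat.le_mul_of_pos_left _ hj)
  induction R generalizing i with
  | zero =>
    have hiM : M ≤ i := by simpa using hi.le
    have := hN.cur_leaf (i * D + d) (le_number hi.pos)
    rw [mul_add_div_of_lt hd, Nat.mul_add_mod_of_lt hd] at this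
    simp [hL.leaf i hi.pos hiM hi.lt_two_mul, this hiM hi.lt_two_mul, eq_comm]
  | succ R ih =>
    have c_lt {j : ℕ} (hj : HasHeight M R j) : c j < X :=
      hL.lt hbl (hN.tab_lt hX) hj.pos hj.lt_two_mul
    have cur_lt {j : ℕ} (hj : HasHeight M R j) : cur (j * D + d) < X :=
      hN.cur_lt _ (le_number hj.pos) (by rw [mul_add_div_of_lt hd]; exact hj.lt_two_mul)
    have cur_ne : cur (i * D + d) ≠ 0 :=
      hN.cur_ne _ (le_number hi.pos) (by rw [mul_add_div_of_lt hd]; exact hi.lt_two_mul)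
    have cur_node := hN.cur_node (i * D + d) (le_number hi.pos)
      (by rw [mul_add_div_of_lt hd]; exact hi.lt_leaves)
    rw [slot_mul_add hd] at cur_node
    rw [← cur_node] at cur_ne
    have same_entry {a a' : ℕ} (ha' : tab a' ≠ 0) : tab a = tab a' ↔ a = a' :=
      ⟨fun h => (hN.tab_inj _ _ ha' h.symm).symm, congrArg tab⟩
    rw [hL.node i hi.pos hi.lt_leaves, ← cur_node, same_entry cur_ne,
      pairKey_inj (c_lt hi.left) (c_lt hi.right) (cur_lt hi.left) (cur_lt hi.right),
      descendants_succ, Finset.forall_mem_union]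
    exact (and_iff_right rfl).trans (and_congr (ih hi.left) (ih hi.right))

theorem Naming.lookup_ne_zero_iff {R : ℕ} (hN : Naming leaf M D X tab cur cnt D)
    (hL : Lookup bl M X tab c 1) (hD : 0 < D) (hX : 2 * M * D < X) (hbl : ∀ i, bl i < X)
    (hi : HasHeight M (R + 1) i) :
    c i ≠ 0 ↔ ∃ d < D, ∀ y ∈ descendants (R + 1) i, leaf d y = bl y := by
  constructor
  · intro hne
    rw [hL.node i hi.pos hi.lt_leaves] at hne
    obtain ⟨y, hy, hyM, hslot⟩ := hN.tab_ne _ hne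
    have hd := Nat.mod_lt y hD
    have hy0 : 1 ≤ y / D := (Nat.one_le_div_iff hD).2 hy
    have c_lt {j : ℕ} (hj : HasHeight M R j) : c j < X :=
      hL.lt hbl (hN.tab_lt hX) hj.pos hj.lt_two_mul
    have cur_lt {j : ℕ} (hj : 1 ≤ j) (hjM : j < 2 * M) : cur (j * D + y % D) < X :=
      hN.cur_lt _ (Nat.le_add_right_of_le (Nat.le_mul_of_pos_left _ hj))
        (by rwa [mul_add_div_of_lt hd])
    obtain ⟨rfl, -, -⟩ := (pairKey_inj (c_lt hi.left) (c_lt hi.right)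
      (cur_lt (by omega) (by omega)) (cur_lt (by omega) (by omega))).1 hslot
    refine ⟨y % D, hd, (hN.lookup_eq_iff hL hX hbl hi hd).1 ?_⟩
    rw [hL.node _ hi.pos hi.lt_leaves, hslot, hN.cur_node y hy hyM, Nat.div_add_mod']
  · rintro ⟨d, hd, hmatch⟩
    rw [(hN.lookup_eq_iff hL hX hbl hi hd).2 hmatch]
    exact hN.cur_ne _ (Nat.le_add_right_of_le (Nat.le_mul_of_pos_left _ hi.pos))
      (by rw [mul_add_div_of_lt hd]; exact hi.lt_two_mul)

end Naming

end GapEdit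

namespace GapEdit

/-! ### Counting the nodes without a match -/

/-- The number of nodes with `c = 0` in the generations `0, …, R` below node `i`. -/
def zeros (c : ℕ → ℕ) (i R : ℕ) : ℕ :=
  ∑ r ∈ Finset.range (R + 1), ((descendants r i).filter (c · = 0)).card

/-- In the tree whose leaves `2 ^ h, …, 2 * 2 ^ h - 1` stand for consecutive blocks of length `k`,
the first position that belongs to node `i` of height `R`. -/
def nodeStart (h k R i : ℕ) : ℕ := (i * 2 ^ R - 2 ^ h) * k

section Zeros

variable {c : ℕ → ℕ} {h k i R : ℕ}

theorem zeros_succ :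
    zeros c i (R + 1) =
      (if c i = 0 then 1 else 0) + (zeros c (2 * i) R + zeros c (2 * i + 1) R) := by
  simp only [zeros]
  rw [Finset.sum_range_succ', ← Finset.sum_add_distrib, add_comm]
  congr 1
  · rw [descendants_zero, Finset.filter_singleton]
    split_ifs <;> rfl
  · refine Finset.sum_congr rfl fun r _ => ?_
    rw [descendants_succ, Finset.filter_union, Finset.card_union_of_disjoint
      (Finset.disjoint_filter_filter disjoint_descendants_children)]

theorem zeros_root : zeros c 1 h = ((Finset.Ico 1 (2 * 2 ^ h)).filter (c · = 0)).card := by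
  induction h with
  | zero => simp [zeros]
  | succ h ih =>
    have hunion : Finset.Ico 1 (2 * 2 ^ (h + 1)) =
        Finset.Ico 1 (2 * 2 ^ h) ∪ descendants (h + 1) 1 := by
      rw [descendants, one_mul, pow_succ', Finset.Ico_union_Ico_eq_Ico] <;>
        have := Nat.one_le_two_pow (n := h) <;> omega
    have hdisj : Disjoint (Finset.Ico 1 (2 * 2 ^ h)) (descendants (h + 1) 1) := by
      rw [descendants, one_mul, pow_succ']
      exact Finset.Ico_disjoint_Ico_consecutive ..
    rw [hunion, Finset.filter_union,
      Finset.card_union_of_disjoint (Finset.disjoint_filter_filter hdisj), ← ih]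
    exact Finset.sum_range_succ ..

theorem nodeStart_mono {R' i' : ℕ} (hle : i * 2 ^ R ≤ i' * 2 ^ R') :
    nodeStart h k R i ≤ nodeStart h k R' i' :=
  Nat.mul_le_mul_right k (Nat.sub_le_sub_right hle _)

theorem nodeStart_left : nodeStart h k R (2 * i) = nodeStart h k (R + 1) i := by
  simp only [nodeStart]; congr 2; ring

theorem nodeStart_right_succ : nodeStart h k R (2 * i + 1 + 1) = nodeStart h k (R + 1) (i + 1) := by
  simp only [nodeStart]; congr 2; ring

theorem HasHeight.nodeStart_succ_le (hi : HasHeight (2 ^ h) 0 i) :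
    nodeStart h k 0 (i + 1) ≤ nodeStart h k 0 i + k := by
  have := hi.le
  simp only [nodeStart, pow_zero, mul_one] at *
  rw [Nat.sub_add_comm this, Nat.succ_mul]

theorem zeros_root_le (S : Finset ℕ) (hS : ∀ i R, HasHeight (2 ^ h) R i → c i = 0 →
      ∃ x ∈ S, nodeStart h k R i ≤ x ∧ x < nodeStart h k R (i + 1)) :
    zeros c 1 h ≤ (h + 1) * S.card := by
  rw [zeros, ← smul_eq_mul, ← Finset.card_range (h + 1), ← Finset.sum_const, Finset.card_range]
  refine Finset.sum_le_sum fun r hr => ?_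
  obtain ⟨R, rfl⟩ := Nat.exists_eq_add_of_le (Finset.mem_range_succ_iff.1 hr)
  have hit (i : ℕ) (hi : i ∈ (descendants r 1).filter (c · = 0)) :
      ∃ x ∈ S, nodeStart (r + R) k R i ≤ x ∧ x < nodeStart (r + R) k R (i + 1) := by
    rw [Finset.mem_filter, mem_descendants, one_mul] at hi
    refine hS i R ⟨?_, ?_⟩ hi.2
    · rw [pow_add]; exact Nat.mul_le_mul_right _ hi.1.1
    · rw [pow_add, ← mul_assoc]; exact Nat.mul_le_mul_right _ hi.1.2
  choose! f hfS hf using hit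
  -- Nodes of one generation have disjoint intervals, so an element of `S` lies in at most one.
  refine Finset.card_le_card_of_injOn f hfS fun i hi j hj hij => ?_
  by_contra hne
  have hsep {i j : ℕ} (hlt : i < j) :
      nodeStart (r + R) k R (i + 1) ≤ nodeStart (r + R) k R j :=
    nodeStart_mono (Nat.mul_le_mul_right _ hlt)
  have := hf i hi
  have := hf j hj
  rcases Nat.lt_or_gt_of_ne hne with hlt | hlt <;>
    have := hsep hlt <;> omega

theorem editsWithin_of_zeros {α : Type} (f g : ℕ → α) {n K : ℕ} (hK : 2 * k ≤ K)
    (hc : ∀ i R a m, HasHeight (2 ^ h) R i → c i ≠ 0 → a = min (nodeStart h k R i) n →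
      a + m = min (nodeStart h k R (i + 1)) n → EditsWithin K (seg f a m) (seg g a m))
    {a m : ℕ} (hi : HasHeight (2 ^ h) R i) (ha : a = min (nodeStart h k R i) n)
    (hm : a + m = min (nodeStart h k R (i + 1)) n) :
    EditsWithin ((zeros c i R + 1) * K) (seg f a m) (seg g a m) := by
  induction R generalizing i a m with
  | zero =>
    have hmk : m ≤ k := by
      have := hi.nodeStart_succ_le (k := k)
      omega
    refine (editsWithin_length_add_length _ _).mono ?_
    simp only [length_seg]
    nlinarith
  | succ R ih =>
    by_cases hci : c i = 0
    · have hmid := nodeStart_mono (h := h) (k := k)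
        (Nat.mul_le_mul_right (2 ^ R) (Nat.le_add_right (2 * i) 1))
      have hmid' := nodeStart_mono (h := h) (k := k)
        (Nat.mul_le_mul_right (2 ^ R) (Nat.le_add_right (2 * i + 1) 1))
      rw [← nodeStart_left] at ha
      rw [← nodeStart_right_succ] at hm
      obtain ⟨m₁, hm₁⟩ := Nat.exists_eq_add_of_le
        (show a ≤ min (nodeStart h k R (2 * i + 1)) n by omega)
      have hm₁_le : m₁ ≤ m := by omega
      obtain ⟨m₂, rfl⟩ := Nat.exists_eq_add_of_le hm₁_le
      have hleft := ih hi.left ha hm₁.symm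
      have hright := ih (m := m₂) hi.right hm₁.symm (by omega)
      rw [seg_add, seg_add]
      refine (hleft.append hright).mono ?_
      rw [zeros_succ, if_pos hci]
      nlinarith
    · exact (hc i (R + 1) a m hi hci ha hm).mono (Nat.le_mul_of_pos_left _ (Nat.succ_pos _))

end Zeros

end GapEdit

namespace GapEdit

/-! ### The parameters of the data structure -/

/-- The least `m` with `b ≤ 2 ^ m * a`. -/
def doublings (a b : ℕ) : ℕ := Nat.clog 2 (b ⌈/⌉ a)

section Doublings

variable {a b m : ℕ}

theorem doublings_le_iff (ha : 0 < a) : doublings a b ≤ m ↔ b ≤ 2 ^ m * a := by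
  rw [doublings, Nat.clog_le_iff_le_pow one_lt_two, ceilDiv_le_iff_le_mul ha, mul_comm]

theorem lt_doublings_iff (ha : 0 < a) : m < doublings a b ↔ 2 ^ m * a < b := by
  simpa only [not_le] using (doublings_le_iff ha).not

theorem le_two_pow_doublings_mul (b : ℕ) (ha : 0 < a) : b ≤ 2 ^ doublings a b * a :=
  (doublings_le_iff ha).1 le_rfl

theorem two_pow_doublings_mul_le (ha : 0 < a) (hab : a ≤ 2 * b) :
    2 ^ doublings a b * a ≤ 2 * b := by
  rcases h : doublings a b with - | m
  · simpa using hab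
  · have := (lt_doublings_iff (b := b) ha).1 (by omega : m < _)
    rw [pow_succ']
    linarith

theorem doublings_one_succ {n : ℕ} (hn : n ≠ 0) : doublings 1 (n + 1) = Nat.log 2 n + 1 := by
  refine eq_of_forall_ge_iff fun m => ?_
  rw [doublings_le_iff one_pos, mul_one, Nat.succ_le_iff, Nat.succ_le_iff,
    Nat.log_lt_iff_lt_pow one_lt_two hn]

end Doublings

/-- The length, the threshold and the size of the alphabet, from which all other parameters are
derived. -/
structure Params where
  n : ℕ
  k : ℕ
  σ : ℕ
  two_le_n : 2 ≤ n
  one_le_k : 1 ≤ k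
  k_le_n : k ≤ n

namespace Params

variable (p : Params)

/-- The word length of the machine. -/
def w : ℕ := wordSize 20 p.n p.σ

/-- The logarithm of the length, rounded down. -/
def l : ℕ := Nat.log 2 p.n

/-- The largest shift by which the strings are compared. -/
def s : ℕ := p.k / (2 * p.l)

/-- There are `2 ^ h` blocks of length `k`; the last ones may lie beyond the end of the string. -/
def h : ℕ := doublings p.k p.n

/-- There are `2 ^ t` samples in every block. -/
def t : ℕ := doublings 1 (16 * (p.l + 2))

/-- The number of samples, which are the leaves of the tree of the string. -/
def leaves : ℕ := 2 ^ p.h * 2 ^ p.t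

/-- The number of shifts, and thus of copies of the tree. -/
def copies : ℕ := 2 * p.s + 1

/-- All names of nodes, and all other small numbers that occur, are less than this. -/
def nameBound : ℕ := 600 * p.n * p.n * (p.σ + 2)

theorem one_le_l : 1 ≤ p.l := Nat.log_pos one_lt_two p.two_le_n

theorem two_pow_l_le : 2 ^ p.l ≤ p.n := Nat.pow_log_le_self 2 (by have := p.two_le_n; omega)

theorem lt_two_pow_l : p.n < 2 ^ (p.l + 1) := Nat.lt_pow_succ_log_self one_lt_two _

theorem l_lt_n : p.l < p.n := Nat.lt_two_pow_self.trans_le p.two_pow_l_le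

theorem s_mul_le : p.s * (2 * p.l) ≤ p.k := Nat.div_mul_le_self ..

theorem two_mul_s_le : 2 * p.s ≤ p.k :=
  calc 2 * p.s ≤ p.s * (2 * p.l) := by have := p.one_le_l; nlinarith
    _ ≤ p.k := p.s_mul_le

theorem n_le_blocks : p.n ≤ 2 ^ p.h * p.k := le_two_pow_doublings_mul _ p.one_le_k

theorem blocks_le : 2 ^ p.h * p.k ≤ 2 * p.n :=
  two_pow_doublings_mul_le p.one_le_k (by have := p.k_le_n; omega)

theorem h_le : p.h ≤ p.l + 1 :=
  (doublings_le_iff p.one_le_k).2 (p.lt_two_pow_l.le.trans (Nat.le_mul_of_pos_right _ p.one_le_k))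

theorem le_samples : 16 * (p.l + 2) ≤ 2 ^ p.t := by
  have := le_two_pow_doublings_mul (16 * (p.l + 2)) one_pos
  rwa [mul_one] at this

theorem samples_le : 2 ^ p.t ≤ 32 * (p.l + 2) := by
  have := two_pow_doublings_mul_le (a := 1) (b := 16 * (p.l + 2)) one_pos (by omega)
  rw [t]
  omega

theorem samples_le_mul_l : 2 ^ p.t ≤ 96 * p.l := by
  have := p.samples_le
  have := p.one_le_l
  omega

theorem samples_le_n : 2 ^ p.t ≤ 64 * p.n := by
  have := p.samples_le
  have := p.l_lt_n
  have := p.two_le_n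
  omega

theorem two_pow_h_le : 2 ^ p.h ≤ 2 * p.n :=
  (Nat.le_mul_of_pos_right _ p.one_le_k).trans p.blocks_le

theorem leaves_le : p.leaves ≤ 128 * (p.n * p.n) :=
  (Nat.mul_le_mul p.two_pow_h_le p.samples_le_n).trans_eq (by ring)

theorem two_pow_h_le_leaves : 2 ^ p.h ≤ p.leaves :=
  Nat.le_mul_of_pos_right _ (by positivity)

theorem leaves_pos : 0 < p.leaves := Nat.mul_pos (by positivity) (by positivity)

theorem copies_pos : 0 < p.copies := Nat.succ_pos _

theorem copies_le : p.copies ≤ p.k + 1 := Nat.succ_le_succ p.two_mul_s_le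

theorem two_pow_h_mul_copies_le : 2 ^ p.h * p.copies ≤ 4 * p.n :=
  calc 2 ^ p.h * p.copies ≤ 2 ^ p.h * (p.k + 1) := Nat.mul_le_mul_left _ p.copies_le
    _ = 2 ^ p.h * p.k + 2 ^ p.h := by ring
    _ ≤ 4 * p.n := by have := p.blocks_le; have := p.two_pow_h_le; omega

theorem le_nameBound : 600 * (p.n * p.n) + 2 * p.σ + 200 ≤ p.nameBound := by
  have hn := p.two_le_n
  have hnn : 4 ≤ p.n * p.n := by nlinarith
  have hbound : p.nameBound = 600 * (p.n * p.n) * (p.σ + 2) := by rw [nameBound]; ring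
  rw [hbound]
  nlinarith

theorem le_nameBound_of_n : 1200 * p.n + 2 * p.σ + 200 ≤ p.nameBound := by
  have := p.le_nameBound
  have := Nat.mul_le_mul_right p.n p.two_le_n
  omega

theorem nodes_lt_nameBound : 2 * p.leaves * p.copies < p.nameBound := by
  have hnodes : 2 * p.leaves * p.copies ≤ 512 * (p.n * p.n) :=
    calc 2 * p.leaves * p.copies = 2 * (2 ^ p.h * p.copies) * 2 ^ p.t := by rw [leaves]; ring
      _ ≤ 2 * (4 * p.n) * (64 * p.n) := Nat.mul_le_mul
        (Nat.mul_le_mul_left _ p.two_pow_h_mul_copies_le) p.samples_le_n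
      _ = 512 * (p.n * p.n) := by ring
  have := p.le_nameBound
  omega

theorem two_mul_leaves_lt_nameBound : 2 * p.leaves < p.nameBound :=
  (Nat.le_mul_of_pos_right _ p.copies_pos).trans_lt p.nodes_lt_nameBound

theorem leaves_lt_nameBound : p.leaves < p.nameBound := by
  have := p.two_mul_leaves_lt_nameBound
  omega

theorem le_two_pow_w : 50000000 * p.n ^ 6 * (p.σ + 2) ^ 2 ≤ 2 ^ p.w := by
  have hn : p.n ≤ 2 ^ p.n.size := p.n.lt_size_self.le
  have hσ : p.σ + 2 ≤ 2 ^ (p.σ.size + 1) := by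
    have := p.σ.lt_size_self
    omega
  have hsize : 2 ≤ p.n.size := Nat.lt_size.2 p.two_le_n
  calc 50000000 * p.n ^ 6 * (p.σ + 2) ^ 2
      ≤ 2 ^ (13 * p.n.size) * (2 ^ p.n.size) ^ 6 * (2 ^ (p.σ.size + 1)) ^ 2 := by
        gcongr
        exact le_trans (by norm_num) (Nat.pow_le_pow_right two_pos (by omega : 26 ≤ _))
    _ = 2 ^ (19 * p.n.size + 2 * p.σ.size + 2) := by ring
    _ ≤ 2 ^ p.w := Nat.pow_le_pow_right two_pos (by rw [w, wordSize]; omega)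

theorem keys_le : p.leaves * p.nameBound * p.nameBound ≤ 2 ^ p.w :=
  calc p.leaves * p.nameBound * p.nameBound
      ≤ 128 * (p.n * p.n) * p.nameBound * p.nameBound := by gcongr; exact p.leaves_le
    _ = 46080000 * p.n ^ 6 * (p.σ + 2) ^ 2 := by rw [nameBound]; ring
    _ ≤ 50000000 * p.n ^ 6 * (p.σ + 2) ^ 2 := by gcongr; norm_num
    _ ≤ 2 ^ p.w := p.le_two_pow_w

theorem two_mul_nameBound_lt : 2 * p.nameBound < 2 ^ p.w := by
  have hX := p.le_nameBound
  refine lt_of_lt_of_le ?_ p.keys_le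
  exact Nat.mul_lt_mul_of_pos_right ((by omega : 2 < p.nameBound).trans_le
    (Nat.le_mul_of_pos_left _ p.leaves_pos)) (by omega)

theorem k_le_two_pow_w : p.k ≤ 2 ^ p.w := by
  have := p.k_le_n
  have := p.le_nameBound_of_n
  have := p.two_mul_nameBound_lt
  omega

end Params

end GapEdit

open WordRAM.Expr (reg load inA inB)

namespace WordRAM

/-! ### Repeated doubling -/

/-- Puts the least `m` with `b ≤ 2 ^ m * a` into register `16`, and `2 ^ m` into register `15`. -/
def doubleCmd (a b : Expr) : Cmd := block [
  .assign 13 a,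
  .assign 14 b,
  .assign 15 1,
  .assign 16 0,
  .loop (.bin .lt (reg 15 * reg 13) (reg 14)) (block [
    .assign 15 (reg 15 + reg 15),
    .assign 16 (reg 16 + 1)])]

/-- The state that `doubleCmd` leaves. -/
def State.doubled (s : State) (a b m : ℕ) : State :=
  (((s.setReg 13 a).setReg 14 b).setReg 15 (2 ^ m)).setReg 16 m

end WordRAM

namespace GapEdit

open WordRAM

theorem runs_doubling {E : Env} {s : State} {a b m : ℕ} (hm : 2 ^ (m + 1) < 2 ^ E.w) :
    Runs E (block [.assign 15 (.reg 15 + .reg 15), .assign 16 (.reg 16 + 1)]) (s.doubled a b m) 9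
      (· = s.doubled a b (m + 1)) := by
  have hm' : m + 1 < 2 ^ E.w := Nat.lt_two_pow_self.trans hm
  refine Runs.cons <| .assign (2 ^ (m + 1)) ?_ <| .cons <| .assign (m + 1) ?_ <| .nil ?_
  · simpa [State.doubled, ← mul_two, ← pow_succ] using Nat.mod_eq_of_lt hm
  · simp [State.doubled, Nat.mod_eq_of_lt hm']
  · simp only [State.doubled, State.setReg]
    congr 1
    rw [Function.update_comm (by norm_num : 15 ≠ 16), Function.update_idem,
      Function.update_comm (by norm_num : 16 ≠ 15), Function.update_idem]

theorem runs_doubleCmd {E : Env} {s : State} {ea eb : Expr} {Q : State → Prop} (a b : ℕ)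
    (hea : ea.eval E s = a) (heb : eb.eval E (s.setReg 13 a) = b) (ha : 0 < a)
    (hab : a ≤ b) (hb : 2 * b < 2 ^ E.w) (hQ : Q (s.doubled a b (doublings a b))) :
    Runs E (doubleCmd ea eb) s (15 * doublings a b + ea.cost + eb.cost + 13) Q := by
  have hpow {j : ℕ} (hj : j ≤ doublings a b) : 2 ^ j * a < 2 ^ E.w :=
    (Nat.mul_le_mul_right a (Nat.pow_le_pow_right two_pos hj)).trans_lt
      ((two_pow_doublings_mul_le ha (by omega)).trans_lt hb)
  have htest {j : ℕ} (hj : j ≤ doublings a b) :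
      (Expr.bin .lt (.reg 15 * .reg 13) (.reg 14)).eval E (s.doubled a b j) =
        if 2 ^ j * a < b then 1 else 0 := by
    simp [State.doubled, Nat.mod_eq_of_lt (hpow hj)]
  have hone : 1 % 2 ^ E.w = 1 := Nat.mod_eq_of_lt (by omega)
  refine (Runs.cons <| .assign a hea <| .cons <| .assign b heb <| .cons <|
    .assign 1 (by simpa using hone) <| .cons <| .assign 0 (by simp) <| .cons (b' := 1) <|
    (Runs.loop (b := 9) (fun m s' => ∃ j, j + m = doublings a b ∧ s' = s.doubled a b j) ?_ ?_
      (doublings a b) ⟨0, by simp, rfl⟩).imp ?_).of_le ?_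
  · rintro m _ ⟨j, hj, rfl⟩
    have hlt := (lt_doublings_iff (b := b) ha).1 (by omega : j < _)
    refine ⟨by simp [htest (by omega : j ≤ _), hlt], (runs_doubling ?_).imp ?_⟩
    · exact (Nat.le_mul_of_pos_right _ ha).trans_lt (hpow (by omega))
    · rintro _ rfl
      exact ⟨j + 1, by omega, rfl⟩
  · rintro _ ⟨_, rfl, rfl⟩
    simp [htest le_rfl, (le_two_pow_doublings_mul b ha).not_gt]
  · rintro _ ⟨_, rfl, rfl⟩
    exact .nil hQ
  · simp [Expr.cost]
    omega

/-! ### The programs -/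

/-- Computes the parameters. The registers of all programs are: `0`, `1`, `2` the input `n`, `k`,
`σ`; `4` and `6` to `11` the parameters as in `Params.Ready`; `12` the number of the current sample
or node; `13` to `16` temporary values. The work arrays are: `0` the positions of the samples, `1`
the dictionary from keys to names, `2` and `3` the names of the nodes for the first and for the
second string. -/
def setupCmd : Cmd := block [
  doubleCmd 1 (reg 0 + 1),
  .assign 4 (reg 16 - 1),
  .assign 6 (reg 1 / (2 * reg 4)),
  doubleCmd (reg 1) (reg 0),
  .assign 7 (reg 15),
  doubleCmd 1 (16 * (reg 4 + 2)),
  .assign 8 (reg 15),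
  .assign 9 (reg 7 * reg 8),
  .assign 10 (600 * reg 0 * reg 0 * (reg 2 + 2)),
  .assign 11 (2 * reg 6 + 1)]

namespace Params

/-- The parameters are in their registers. -/
structure Ready (p : Params) (st : State) : Prop where
  reg_zero : st.reg 0 = p.n
  reg_one : st.reg 1 = p.k
  reg_four : st.reg 4 = p.l
  reg_six : st.reg 6 = p.s
  reg_seven : st.reg 7 = 2 ^ p.h
  reg_eight : st.reg 8 = 2 ^ p.t
  reg_nine : st.reg 9 = p.leaves
  reg_ten : st.reg 10 = p.nameBound
  reg_eleven : st.reg 11 = p.copies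

/-- The word length is the one for the parameters, and the symbols are at most `σ`. -/
structure IsEnv (p : Params) (E : Env) : Prop where
  w_eq : E.w = p.w
  strA_le : ∀ i, E.strA i ≤ p.σ
  strB_le : ∀ i, E.strB i ≤ p.σ

variable {p : Params} {E : Env} {st st' : State}

theorem Ready.congr (hr : p.Ready st) (h : ∀ r ≤ 11, st'.reg r = st.reg r) : p.Ready st' := by
  constructor <;> rw [h _ (by norm_num)]
  exacts [hr.reg_zero, hr.reg_one, hr.reg_four, hr.reg_six, hr.reg_seven, hr.reg_eight,
    hr.reg_nine, hr.reg_ten, hr.reg_eleven]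

theorem IsEnv.two_mul_nameBound_lt (hE : p.IsEnv E) : 2 * p.nameBound < 2 ^ E.w :=
  hE.w_eq ▸ p.two_mul_nameBound_lt

theorem IsEnv.mod_eq (hE : p.IsEnv E) {x : ℕ} (hx : x ≤ p.nameBound) : x % 2 ^ E.w = x :=
  Nat.mod_eq_of_lt (by have := hE.two_mul_nameBound_lt; omega)

theorem runs_setupCmd (hE : p.IsEnv E) (h0 : st.reg 0 = p.n) (h1 : st.reg 1 = p.k)
    (h2 : st.reg 2 = p.σ) :
    Runs E setupCmd st (1700 * p.l) fun st' => p.Ready st' ∧ st'.mem = st.mem ∧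
      st'.pos = st.pos := by
  have hX := p.le_nameBound_of_n
  have hXw := hE.two_mul_nameBound_lt
  have hl : doublings 1 (p.n + 1) = p.l + 1 := doublings_one_succ (by have := p.two_le_n; omega)
  have hone := p.one_le_l
  have hln := p.l_lt_n
  have hkn := p.k_le_n
  have hs := p.two_mul_s_le
  have hc {x : ℕ} (hx : x ≤ 600) : x % 2 ^ E.w = x := hE.mod_eq (by omega)
  have hm {x : ℕ} (hx : x ≤ p.nameBound) : x % 2 ^ E.w = x := hE.mod_eq hx
  refine (Runs.cons <| runs_doubleCmd 1 (p.n + 1) ?_ ?_ one_pos (by omega) (by omega) <|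
    .cons <| .assign p.l ?_ <| .cons <| .assign p.s ?_ <|
    .cons <| runs_doubleCmd p.k p.n ?_ ?_ p.one_le_k hkn (by omega) <|
    .cons <| .assign (2 ^ p.h) ?_ <|
    .cons <| runs_doubleCmd 1 (16 * (p.l + 2)) ?_ ?_ one_pos (by omega) (by omega) <|
    .cons <| .assign (2 ^ p.t) ?_ <| .cons <| .assign p.leaves ?_ <|
    .cons <| .assign p.nameBound ?_ <| .cons <| .assign p.copies ?_ <| .nil ?_).of_le ?_
  · simp [hc]
  · simp [hc, h0, hm (by omega : p.n + 1 ≤ _)]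
  · simp [State.doubled, hc, hl]
  · simp [State.doubled, hc, h1, s, hm (by omega : 2 * p.l ≤ _)]
  · simp [State.doubled, h1]
  · simp [State.doubled, h0]
  · simp [State.doubled, h]
  · simp [hc]
  · simp [State.doubled, hc, hl, hm (by omega : p.l + 2 ≤ _), hm (by omega : 16 * (p.l + 2) ≤ _)]
  · simp [State.doubled, t]
  · simpa [State.doubled, leaves] using hm p.leaves_lt_nameBound.le
  · have hbound : 600 * p.n ≤ p.nameBound := by omega
    have hbound' : 600 * p.n * p.n ≤ p.nameBound := Nat.le_mul_of_pos_right _ (by omega)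
    simpa [State.doubled, hc, h0, h2, hm hbound, hm hbound', hm (by omega : p.σ + 2 ≤ _),
      nameBound] using hm (x := p.nameBound) le_rfl
  · simp [State.doubled, hc, hm (by omega : 2 * p.s ≤ _), hm (by omega : 2 * p.s + 1 ≤ _), copies]
  · exact ⟨by constructor <;> simp [State.doubled, h0, h1], by simp [State.doubled],
      by simp [State.doubled]⟩
  · have hh := p.h_le
    have ht : p.t < 32 * (p.l + 2) := Nat.lt_two_pow_self.trans_le p.samples_le
    simp only [h, t] at hh ht
    simp [Expr.cost, hl]
    omega

end Params

end GapEdit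

namespace GapEdit

open WordRAM

/-- The body of the loop of `sampleCmd`. -/
def sampleStep : Cmd := block [
  .rand 13,
  .store 0 (reg 12) (reg 12 / reg 8 * reg 1 + reg 13 % reg 1),
  .assign 12 (reg 12 + 1)]

/-- Draws the positions of the samples, `2 ^ t` of them in every block. -/
def sampleCmd : Cmd := block [
  .assign 12 0,
  .loop (.bin .lt (reg 12) (reg 9)) sampleStep]

/-- The address in the dictionary for the node `i` whose children have the names `l` and `r`. -/
def pairKeyExpr (i l r : Expr) : Expr := (i * reg 10 + l) * reg 10 + r

/-- The address in the dictionary for the node in register `13` of the copy in register `14`. -/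
def slotExpr : Expr :=
  pairKeyExpr (reg 13) (load 2 (2 * reg 13 * reg 11 + reg 14))
    (load 2 ((2 * reg 13 + 1) * reg 11 + reg 14))

/-- Names the inner node in register `13` of the copy in register `14`. -/
def nameNode : Cmd := block [
  .assign 16 slotExpr,
  .branch (load 1 (reg 16)) .skip (block [.assign 15 (reg 15 + 1), .store 1 (reg 16) (reg 15)]),
  .store 2 (reg 12) (load 1 (reg 16))]

/-- Names the leaf in register `13` of the copy in register `14`. -/
def nameLeaf : Cmd := block [
  .assign 16 (load 0 (reg 13 - reg 9) + reg 14),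
  .branch (.bin .lt (reg 16) (reg 6)) (.store 2 (reg 12) 1)
    (.store 2 (reg 12) (inA (reg 16 - reg 6) + 1))]

/-- The body of the loop of `nameCmd`. -/
def nameStep : Cmd := block [
  .assign 12 (reg 12 - 1),
  .assign 13 (reg 12 / reg 11),
  .assign 14 (reg 12 % reg 11),
  .branch (.bin .lt (reg 13) (reg 9)) nameNode nameLeaf]

/-- Names the nodes of the trees of all shifts, in decreasing order of their numbers. -/
def nameCmd : Cmd := block [
  .assign 12 (2 * reg 9 * reg 11),
  .assign 15 0,
  .loop (.bin .lt (reg 11) (reg 12)) nameStep]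

/-- The symbol at position `q` of the string `a` shifted by `d - s`, increased by `1` so that it is
no empty entry of the dictionary. A position out of range counts as the symbol `0`. -/
def shiftSym (s : ℕ) (a : ℕ → ℕ) (d q : ℕ) : ℕ := if q + d < s then 1 else a (q + d - s) + 1

namespace Params

variable (p : Params)

/-- The position of sample `j`. -/
def samplePos (tape : ℕ → ℕ) (j : ℕ) : ℕ := j / 2 ^ p.t * p.k + tape j % p.k

/-- The name of leaf `y` for the string `a` and the sample positions `P`, in the copy `d` of the
tree. -/
def leafName (a P : ℕ → ℕ) (d y : ℕ) : ℕ := shiftSym p.s a d (P (y - p.leaves))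

/-- The state when `j` positions have been drawn. -/
structure Sampled (tape : ℕ → ℕ) (j : ℕ) (st : State) : Prop where
  ready : p.Ready st
  current : st.reg 12 = j
  pos_eq : st.pos = j
  samples : ∀ i < j, st.mem 0 i = p.samplePos tape i
  dict_empty : st.mem 1 = fun _ => 0

/-- The state when the nodes of number at least `z` have a name. -/
structure Named (E : Env) (P : ℕ → ℕ) (z : ℕ) (st : State) : Prop where
  ready : p.Ready st
  samples : ∀ j < p.leaves, st.mem 0 j = P j
  naming : Naming (p.leafName E.strA P) p.leaves p.copies p.nameBound (st.mem 1) (st.mem 2)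
    (st.reg 15) z

variable {p} {E : Env} {P tape : ℕ → ℕ} {st : State} {i d j z : ℕ}

theorem samplePos_lt (tape : ℕ → ℕ) (hj : j < p.leaves) : p.samplePos tape j < 2 * p.n :=
  (mul_add_lt_mul ((Nat.div_lt_iff_lt_mul (by positivity)).2 hj)
    (Nat.mod_lt _ p.one_le_k)).trans_le p.blocks_le

theorem runs_sampleStep (hE : p.IsEnv E) (hS : p.Sampled E.tape j st) (hj : j < p.leaves) :
    Runs E sampleStep st 20 (p.Sampled E.tape (j + 1)) := by
  have hX := p.le_nameBound_of_n
  have hpos := samplePos_lt E.tape hj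
  have hleaves := p.leaves_lt_nameBound
  have hone : 1 % 2 ^ E.w = 1 := hE.mod_eq (by omega)
  have hblock : j / 2 ^ p.t * p.k % 2 ^ E.w = j / 2 ^ p.t * p.k :=
    hE.mod_eq (by simp only [samplePos] at hpos; omega)
  refine (Runs.cons <| .rand <| .cons <| .store j (p.samplePos E.tape j) ?_ ?_ <| .cons <|
    .assign (j + 1) ?_ <| .nil ⟨?_, ?_, ?_, ?_, ?_⟩).of_le (by simp [Expr.cost])
  · simp [hS.current]
  · simpa [hS.current, hS.ready.reg_eight, hS.ready.reg_one, hS.pos_eq, hblock, samplePos]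
      using hE.mod_eq (x := p.samplePos E.tape j) (by omega)
  · simpa [hS.current, hone] using hE.mod_eq (by omega : j + 1 ≤ _)
  · exact hS.ready.congr fun r hr => by simp [show r ≠ 12 by omega, show r ≠ 13 by omega]
  · simp
  · simp [hS.pos_eq]
  · intro i hi
    simp only [State.setReg_mem, State.setMem_mem, if_true, Function.update_apply]
    split_ifs with hij
    · rw [hij]
    · exact hS.samples i (by omega)
  · simpa using hS.dict_empty

theorem runs_sampleCmd (hE : p.IsEnv E) (hr : p.Ready st) (hpos : st.pos = 0)
    (hmem : st.mem 1 = fun _ => 0) :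
    Runs E sampleCmd st (30 * p.leaves + 10) (p.Sampled E.tape p.leaves) := by
  refine (Runs.cons <| .assign 0 (by simp) <| .cons (b' := 1) <| (Runs.loop (b := 20)
    (fun m st' => ∃ j, j + m = p.leaves ∧ p.Sampled E.tape j st') ?_ ?_ p.leaves
    ⟨0, by simp, ?_⟩).imp ?_).of_le ?_
  · rintro m st' ⟨j, hj, hS⟩
    have hlt : j < p.leaves := by omega
    exact ⟨by simp [hS.current, hS.ready.reg_nine, hlt],
      (runs_sampleStep hE hS hlt).imp fun _ hS' => ⟨j + 1, by omega, hS'⟩⟩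
  · rintro st' ⟨_, rfl, hS⟩
    simp [hS.current, hS.ready.reg_nine]
  · exact ⟨hr.congr fun r hr => by simp [show r ≠ 12 by omega], by simp, by simp [hpos], by simp,
      by simpa using hmem⟩
  · rintro st' ⟨_, rfl, hS⟩
    exact .nil hS
  · simp [Expr.cost]
    omega

theorem eval_pairKeyExpr {i l r : Expr} (hE : p.IsEnv E) (hst : p.Ready st)
    (hi : i.eval E st < p.leaves) (hl : l.eval E st < p.nameBound)
    (hr : r.eval E st < p.nameBound) : (pairKeyExpr i l r).eval E st =
      pairKey p.nameBound (i.eval E st) (l.eval E st) (r.eval E st) := by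
  have hkey := (pairKey_lt hi hl hr).trans_le (hE.w_eq ▸ p.keys_le)
  have hle (a : ℕ) : a ≤ a * p.nameBound := Nat.le_mul_of_pos_right a (by omega)
  simp only [pairKey] at hkey ⊢
  have h₁ := hle (i.eval E st * p.nameBound + l.eval E st)
  simp only [pairKeyExpr, Expr.eval_add, Expr.eval_mul, Expr.eval_reg, hst.reg_ten]
  rw [Nat.mod_eq_of_lt (by omega : i.eval E st * p.nameBound < _), Nat.mod_eq_of_lt
    (by omega : i.eval E st * p.nameBound + l.eval E st < _), Nat.mod_eq_of_lt
    (by omega : (i.eval E st * p.nameBound + l.eval E st) * p.nameBound < _), Nat.mod_eq_of_lt hkey]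

theorem Named.setReg (h : p.Named E P z st) {r v : ℕ} (hr : 11 < r) (hr' : r ≠ 15) :
    p.Named E P z (st.setReg r v) where
  ready := h.ready.congr fun q hq => by simp [show q ≠ r by omega]
  samples := h.samples
  naming := by simpa [hr'.symm] using h.naming

theorem eval_slotExpr (hE : p.IsEnv E) (hN : p.Named E P (i * p.copies + d + 1) st)
    (h13 : st.reg 13 = i) (h14 : st.reg 14 = d) (hi : 1 ≤ i) (hi' : i < p.leaves)
    (hd : d < p.copies) : slotExpr.eval E st =
      slot p.nameBound p.copies (st.mem 2) (i * p.copies + d) := by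
  have hX := p.le_nameBound_of_n
  have hX' := p.two_mul_leaves_lt_nameBound
  have hc {x : ℕ} (hx : x ≤ p.nameBound) : x % 2 ^ E.w = x := hE.mod_eq hx
  have hleft : (2 * reg 13 : Expr).eval E st = 2 * i := by
    simp [h13, hc (by omega : 2 ≤ _), hc (by omega : 2 * i ≤ _)]
  have hright : (2 * reg 13 + 1 : Expr).eval E st = 2 * i + 1 := by
    rw [Expr.eval_add, hleft, Expr.eval_ofNat, hc (by omega : 1 ≤ _), hc (by omega)]
  have eval_name {e : Expr} {j : ℕ} (he : e.eval E st = j) (hj : i < j) (hj' : j < 2 * p.leaves) :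
      (load 2 (e * reg 11 + reg 14)).eval E st = st.mem 2 (j * p.copies + d) ∧
        st.mem 2 (j * p.copies + d) < p.nameBound := by
    have hlt := (mul_add_lt_mul hj' hd).trans p.nodes_lt_nameBound
    refine ⟨by simp [he, h14, hN.ready.reg_eleven, hc (by omega : j * p.copies ≤ _), hc hlt.le],
      hN.naming.cur_lt _ (Nat.add_lt_add_right (Nat.mul_lt_mul_of_pos_right hj p.copies_pos) d)
        (by rwa [mul_add_div_of_lt hd])⟩
  obtain ⟨hl, hlX⟩ := eval_name hleft (by omega) (by omega)
  obtain ⟨hr, hrX⟩ := eval_name hright (by omega) (by omega)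
  rw [slot_mul_add hd, slotExpr, eval_pairKeyExpr hE hN.ready (by simpa [h13] using hi')
    (by rwa [hl]) (by rwa [hr]), hl, hr, Expr.eval_reg, h13]

theorem runs_nameNode (hE : p.IsEnv E) (hN : p.Named E P (i * p.copies + d + 1) st)
    (h12 : st.reg 12 = i * p.copies + d) (h13 : st.reg 13 = i) (h14 : st.reg 14 = d)
    (hi : 1 ≤ i) (hi' : i < p.leaves) (hd : d < p.copies) :
    Runs E nameNode st 42 fun st' => p.Named E P (i * p.copies + d) st' ∧
      st'.reg 12 = i * p.copies + d := by
  have hX := p.nodes_lt_nameBound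
  have hz : p.copies ≤ i * p.copies + d := Nat.le_add_right_of_le (Nat.le_mul_of_pos_left _ hi)
  have hzM : (i * p.copies + d) / p.copies < p.leaves := by rwa [mul_add_div_of_lt hd]
  have hcnt := hN.naming.cnt_le
  have hslot := eval_slotExpr hE hN h13 h14 hi hi' hd
  generalize i * p.copies + d = z at *
  refine (Runs.cons <| .assign _ hslot <| .cons <| (Runs.branch
    (Q := fun s => p.Named E P z (s.setMem 2 z (s.mem 1 (s.reg 16))) ∧ s.reg 12 = z)
    (fun hne => .skip ⟨?old, by simpa⟩) fun h0 => .cons <| .assign (st.reg 15 + 1) ?count <|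
      .cons <| .store _ _ rfl rfl <| .nil ⟨?new, by simpa⟩).imp fun s hs =>
    .cons <| .store z _ (by exact hs.2) rfl <| .nil hs).of_le ?_
  case old =>
    exact ⟨hN.ready.congr fun r hr => by simp [show r ≠ 16 by omega], by simpa using hN.samples,
      by simpa using hN.naming.step_old p.copies_pos hz hzM hX (by simpa using hne)⟩
  case count => simpa [hE.mod_eq (by omega : 1 ≤ _)] using hE.mod_eq (by omega : st.reg 15 + 1 ≤ _)
  case new =>
    exact ⟨hN.ready.congr fun r hr => by simp [show r ≠ 16 by omega, show r ≠ 15 by omega],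
      by simpa using hN.samples,
      by simpa using hN.naming.step_new p.copies_pos hz hzM hX (by simpa using h0)⟩
  simp [Expr.cost, slotExpr, pairKeyExpr]

theorem leafName_ne_zero {a : ℕ → ℕ} {y : ℕ} : p.leafName a P d y ≠ 0 := by
  unfold leafName shiftSym
  split_ifs <;> omega

theorem leafName_lt {a : ℕ → ℕ} {y : ℕ} (ha : ∀ i, a i ≤ p.σ) :
    p.leafName a P d y < p.nameBound := by
  have hX := p.le_nameBound_of_n
  have := ha (P (y - p.leaves) + d - p.s)
  unfold leafName shiftSym
  split_ifs <;> omega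

theorem runs_nameLeaf (hE : p.IsEnv E) (hP : ∀ j < p.leaves, P j < 2 * p.n)
    (hN : p.Named E P (i * p.copies + d + 1) st) (h12 : st.reg 12 = i * p.copies + d)
    (h13 : st.reg 13 = i) (h14 : st.reg 14 = d) (hi : p.leaves ≤ i) (hi' : i < 2 * p.leaves)
    (hd : d < p.copies) :
    Runs E nameLeaf st 22 fun st' => p.Named E P (i * p.copies + d) st' ∧
      st'.reg 12 = i * p.copies + d := by
  have hX := p.le_nameBound_of_n
  have hc := p.copies_le
  have hk := p.k_le_n
  have hz : p.copies ≤ i * p.copies + d :=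
    Nat.le_add_right_of_le (Nat.le_mul_of_pos_left _ (p.leaves_pos.trans_le hi))
  have hzi : (i * p.copies + d) / p.copies = i := mul_add_div_of_lt hd
  have hzd : (i * p.copies + d) % p.copies = d := Nat.mul_add_mod_of_lt hd
  have hpos := hP (i - p.leaves) (by omega)
  have hname : p.Named E P (i * p.copies + d)
      ((st.setReg 16 (P (i - p.leaves) + d)).setMem 2 (i * p.copies + d)
        (p.leafName E.strA P d i)) := by
    refine ⟨hN.ready.congr fun r hr => by simp [show r ≠ 16 by omega], by simpa using hN.samples,
      ?_⟩
    simpa [hzd, hzi] using hN.naming.step_leaf p.copies_pos hz (hzi.symm ▸ hi) leafName_ne_zero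
      (leafName_lt hE.strA_le)
  have hone : 1 % 2 ^ E.w = 1 := hE.mod_eq (by omega)
  refine (Runs.cons <| .assign (P (i - p.leaves) + d) ?pos <| .cons <| .branch
    (fun hlt => .store _ (p.leafName E.strA P d i) (by exact h12) ?before <| .nil ⟨hname, h12⟩)
    (fun hge => .store _ (p.leafName E.strA P d i) (by exact h12) ?after <|
      .nil ⟨hname, h12⟩)).of_le (by simp [Expr.cost])
  case pos =>
    simpa [h13, h14, hN.ready.reg_nine, hN.samples _ (by omega : i - p.leaves < p.leaves)]
      using hE.mod_eq (by omega : P (i - p.leaves) + d ≤ _)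
  case before =>
    have hlt' : P (i - p.leaves) + d < p.s := by simpa [hN.ready.reg_six] using hlt
    simpa [leafName, shiftSym, hlt'] using hone
  case after =>
    have hge' : ¬P (i - p.leaves) + d < p.s := by simpa [hN.ready.reg_six] using hge
    have := hE.strA_le (P (i - p.leaves) + d - p.s)
    simpa [leafName, shiftSym, hge', hN.ready.reg_six, hone]
      using hE.mod_eq (by omega : E.strA (P (i - p.leaves) + d - p.s) + 1 ≤ _)

theorem runs_nameStep (hE : p.IsEnv E) (hP : ∀ j < p.leaves, P j < 2 * p.n)
    (hN : p.Named E P (z + 1) st) (h12 : st.reg 12 = z + 1) (hz : p.copies ≤ z)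
    (hz' : z < 2 * p.leaves * p.copies) :
    Runs E nameStep st 59 fun st' => p.Named E P z st' ∧ st'.reg 12 = z := by
  have hX := p.le_nameBound_of_n
  have hone : 1 % 2 ^ E.w = 1 := hE.mod_eq (by omega)
  obtain ⟨i, d, hd, rfl⟩ : ∃ i d, d < p.copies ∧ z = i * p.copies + d :=
    ⟨z / p.copies, z % p.copies, Nat.mod_lt _ p.copies_pos, (Nat.div_add_mod' ..).symm⟩
  have hzi : (i * p.copies + d) / p.copies = i := mul_add_div_of_lt hd
  have hi : 1 ≤ i := hzi ▸ (Nat.one_le_div_iff p.copies_pos).2 hz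
  have hi' : i < 2 * p.leaves := hzi ▸ (Nat.div_lt_iff_lt_mul p.copies_pos).2 hz'
  have hN' := ((hN.setReg (r := 12) (v := i * p.copies + d) (by norm_num) (by norm_num)).setReg
    (r := 13) (v := i) (by norm_num) (by norm_num)).setReg
    (r := 14) (v := d) (by norm_num) (by norm_num)
  refine (Runs.cons <| .assign (i * p.copies + d) ?_ <| .cons <| .assign i ?_ <| .cons <|
    .assign d ?_ <| .cons <| (Runs.branch
      (fun hlt => runs_nameNode hE hN' (by simp) (by simp) (by simp) hi ?_ hd)
      (fun hge => runs_nameLeaf hE hP hN' (by simp) (by simp) (by simp) ?_ hi' hd)).imp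
    fun _ h => .nil h).of_le (by simp [Expr.cost])
  · simp [h12, hone]
  · simpa [hN.ready.reg_eleven] using hzi
  · simpa [hN.ready.reg_eleven] using Nat.mod_eq_of_lt hd
  · simpa [hN.ready.reg_nine] using hlt
  · simpa [hN.ready.reg_nine] using hge

theorem runs_nameCmd (hE : p.IsEnv E) (hP : ∀ j < p.leaves, P j < 2 * p.n) (hr : p.Ready st)
    (hS : ∀ j < p.leaves, st.mem 0 j = P j) (hmem : st.mem 1 = fun _ => 0) :
    Runs E nameCmd st (63 * (2 * p.leaves * p.copies) + 20) (p.Named E P p.copies) := by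
  have hX := p.nodes_lt_nameBound
  have hX' := p.le_nameBound_of_n
  have hX'' := p.two_mul_leaves_lt_nameBound
  have hnodes : p.copies ≤ 2 * p.leaves * p.copies :=
    Nat.le_mul_of_pos_left _ (by have := p.leaves_pos; omega)
  refine (Runs.cons <| .assign (2 * p.leaves * p.copies) ?_ <| .cons <| .assign 0 (by simp) <|
    .cons (b' := 1) <| (Runs.loop (b := 59) (fun m st' => p.Named E P (p.copies + m) st' ∧
      st'.reg 12 = p.copies + m ∧ p.copies + m ≤ 2 * p.leaves * p.copies) ?_ ?_
      (2 * p.leaves * p.copies - p.copies) ⟨⟨?_, ?_, ?_⟩, ?_⟩).imp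
      fun _ h => .nil h.1).of_le ?_
  · simpa [hr.reg_nine, hr.reg_eleven, hE.mod_eq (by omega : 2 ≤ _), hE.mod_eq hX''.le]
      using hE.mod_eq hX.le
  · rintro m st' ⟨hN, h12, hle⟩
    refine ⟨by simp [hN.ready.reg_eleven, h12],
      (runs_nameStep hE hP hN h12 (Nat.le_add_right ..) hle).imp ?_⟩
    exact fun _ h => ⟨h.1, h.2, (Nat.le_succ _).trans hle⟩
  · rintro st' ⟨hN, h12, -⟩
    simp [hN.ready.reg_eleven, h12]
  · exact hr.congr fun r hr => by simp [show r ≠ 12 by omega, show r ≠ 15 by omega]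
  · simpa using hS
  · rw [Nat.add_sub_cancel' hnodes]
    simpa [hmem] using naming_start p.copies_pos
  · simp [Nat.add_sub_cancel' hnodes]
  · simp [Expr.cost]
    omega

end Params

end GapEdit

namespace GapEdit

open WordRAM

/-- Looks up the node in register `12`. -/
def lookupNode : Cmd :=
  .branch (.bin .lt (reg 12) (reg 9))
    (.store 3 (reg 12)
      (load 1 (pairKeyExpr (reg 12) (load 3 (2 * reg 12)) (load 3 (2 * reg 12 + 1)))))
    (.store 3 (reg 12) (inB (load 0 (reg 12 - reg 9)) + 1))

/-- The body of the loop of `lookupCmd`. -/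
def lookupStep : Cmd := block [
  .assign 12 (reg 12 - 1),
  lookupNode,
  .assign 15 (reg 15 + .bin .lt (reg 12) (2 * reg 7) * .bin .eq (load 3 (reg 12)) 0)]

/-- Looks up the nodes of the tree of the second string, counts in register `15` those without a
name that stand for at least one block, and compares the count with `s * (l + 2)`. -/
def lookupCmd : Cmd := block [
  .assign 12 (2 * reg 9),
  .assign 15 0,
  .loop (.bin .lt 1 (reg 12)) lookupStep,
  .assign 0 (.bin .lt (reg 15) (reg 6 * (reg 4 + 2) + 1))]

theorem card_zeros_update (c : ℕ → ℕ) (v z N : ℕ) :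
    ((Finset.Ico z N).filter (Function.update c z v · = 0)).card =
      ((Finset.Ico (z + 1) N).filter (c · = 0)).card +
        (if z < N then 1 else 0) * if v = 0 then 1 else 0 := by
  by_cases hz : z < N
  · have hrest : (Finset.Ico (z + 1) N).filter (Function.update c z v · = 0) =
        (Finset.Ico (z + 1) N).filter (c · = 0) :=
      Finset.filter_congr fun i hi => by
        rw [Function.update_of_ne (by have := Finset.mem_Ico.1 hi; omega)]
    rw [← Finset.insert_Ico_add_one_left_eq_Ico hz, Finset.filter_insert, Function.update_self,
      hrest, if_pos hz, one_mul]
    split_ifs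
    · rw [Finset.card_insert_of_notMem (by simp)]
    · rfl
  · rw [Finset.Ico_eq_empty (by omega), Finset.Ico_eq_empty (by omega), if_neg hz, zero_mul]
    simp

namespace Params

variable (p : Params)

/-- The name of leaf `y` for the string `b` and the sample positions `P`. -/
def lookupName (b P : ℕ → ℕ) (y : ℕ) : ℕ := b (P (y - p.leaves)) + 1

/-- The state when the nodes of number at least `z` have been looked up in the dictionary `tab`. -/
structure LookedUp (E : Env) (P tab : ℕ → ℕ) (z : ℕ) (st : State) : Prop where
  ready : p.Ready st
  current : st.reg 12 = z
  samples : ∀ j < p.leaves, st.mem 0 j = P j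
  dict : st.mem 1 = tab
  count : st.reg 15 = ((Finset.Ico z (2 * 2 ^ p.h)).filter (st.mem 3 · = 0)).card
  lookup : Lookup (p.lookupName E.strB P) p.leaves p.nameBound tab (st.mem 3) z

variable {p} {E : Env} {P tab b : ℕ → ℕ} {st : State} {z : ℕ}

theorem lookupName_lt (hb : ∀ i, b i ≤ p.σ) (y : ℕ) : p.lookupName b P y < p.nameBound := by
  have hX := p.le_nameBound_of_n
  have := hb (P (y - p.leaves))
  rw [lookupName]
  omega

theorem runs_lookupNode (hE : p.IsEnv E) (htab : ∀ a, tab a < p.nameBound) (hz : 1 ≤ z)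
    (hz' : z < 2 * p.leaves) (hr : p.Ready st) (h12 : st.reg 12 = z)
    (hP : ∀ j < p.leaves, st.mem 0 j = P j) (hdict : st.mem 1 = tab)
    (hL : Lookup (p.lookupName E.strB P) p.leaves p.nameBound tab (st.mem 3) (z + 1)) :
    Runs E lookupNode st 24 fun st' => ∃ v, st' = st.setMem 3 z v ∧
      Lookup (p.lookupName E.strB P) p.leaves p.nameBound tab
        (Function.update (st.mem 3) z v) z := by
  have hX := p.le_nameBound_of_n
  have hX' := p.two_mul_leaves_lt_nameBound
  have hname := lookupName_lt (p := p) (P := P) hE.strB_le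
  have hc {x : ℕ} (hx : x ≤ p.nameBound) : x % 2 ^ E.w = x := hE.mod_eq hx
  refine (Runs.branch
    (fun hlt => .store z (tab (pairKey p.nameBound z (st.mem 3 (2 * z)) (st.mem 3 (2 * z + 1))))
      (by exact h12) ?node ⟨_, rfl, hL.step hz (fun h => ?_) fun _ => rfl⟩)
    (fun hge => .store z (p.lookupName E.strB P z) (by exact h12) ?leaf
      ⟨_, rfl, hL.step hz (fun _ => rfl) fun h => ?_⟩)).of_le (by simp [Expr.cost, pairKeyExpr])
  case node =>
    have hzM : z < p.leaves := by simpa [h12, hr.reg_nine] using hlt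
    have hleft : (load 3 (2 * reg 12)).eval E st = st.mem 3 (2 * z) := by
      simp [h12, hc (by omega : 2 ≤ _), hc (by omega : 2 * z ≤ _)]
    have hright : (load 3 (2 * reg 12 + 1)).eval E st = st.mem 3 (2 * z + 1) := by
      simp [h12, hc (by omega : 2 ≤ _), hc (by omega : 1 ≤ _), hc (by omega : 2 * z ≤ _),
        hc (by omega : 2 * z + 1 ≤ _)]
    have child_lt {i : ℕ} (hi : z + 1 ≤ i) (hi' : i < 2 * p.leaves) :
        st.mem 3 i < p.nameBound := hL.lt hname htab hi hi'
    rw [Expr.eval_load, eval_pairKeyExpr hE hr (by simpa [h12] using hzM)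
      (by rw [hleft]; exact child_lt (by omega) (by omega))
      (by rw [hright]; exact child_lt (by omega) (by omega)), hleft, hright, hdict]
    simp [h12]
  case leaf =>
    have hzM : p.leaves ≤ z := by simpa [h12, hr.reg_nine] using hge
    simpa [h12, hr.reg_nine, hP _ (by omega : z - p.leaves < p.leaves), hc (by omega : 1 ≤ _),
      lookupName] using hc (hname z).le
  · have : z < p.leaves := by simpa [h12, hr.reg_nine] using hlt
    omega
  · have : ¬z < p.leaves := by simpa [h12, hr.reg_nine] using hge
    omega

theorem runs_lookupStep (hE : p.IsEnv E) (htab : ∀ a, tab a < p.nameBound) (hz : 1 ≤ z)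
    (hz' : z < 2 * p.leaves) (hI : p.LookedUp E P tab (z + 1) st) :
    Runs E lookupStep st 42 (p.LookedUp E P tab z) := by
  have hX' := p.two_mul_leaves_lt_nameBound
  have hh := p.two_pow_h_le_leaves
  have hc {x : ℕ} (hx : x ≤ p.nameBound) : x % 2 ^ E.w = x := hE.mod_eq hx
  refine (Runs.cons <| .assign z ?_ <| .cons <| (runs_lookupNode
    (st := st.setReg 12 z) hE htab hz hz' ?_ (by simp) hI.samples hI.dict hI.lookup).imp
    ?_).of_le (b := 4 + (24 + 14)) (by norm_num)
  · simp [hI.current, hc (by omega : 1 ≤ _)]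
  · exact hI.ready.congr fun r hr => by simp [show r ≠ 12 by omega]
  rintro _ ⟨v, rfl, hL⟩
  have hcard := card_zeros_update (st.mem 3) v z (2 * 2 ^ p.h)
  have hcard_le : ((Finset.Ico z (2 * 2 ^ p.h)).filter
      (Function.update (st.mem 3) z v · = 0)).card ≤ 2 * 2 ^ p.h :=
    (Finset.card_filter_le _ _).trans (by simp)
  refine .cons <| .assign ((Finset.Ico z (2 * 2 ^ p.h)).filter
    (Function.update (st.mem 3) z v · = 0)).card ?_ <| .nil ⟨?_, ?_, ?_, ?_, ?_, ?_⟩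
  · rw [hcard, ← hI.count] at hcard_le ⊢
    simpa [hI.ready.reg_seven, hc (by omega : 2 ≤ _), hc (by omega : 2 * 2 ^ p.h ≤ _)]
      using hc (hcard_le.trans (by omega))
  · exact hI.ready.congr fun r hr => by simp [show r ≠ 12 by omega, show r ≠ 15 by omega]
  · simp
  · simpa using hI.samples
  · simpa using hI.dict
  · simp
  · simpa using hL

theorem runs_lookupCmd (hE : p.IsEnv E) (hr : p.Ready st) (hP : ∀ j < p.leaves, st.mem 0 j = P j)
    (htab : ∀ a, st.mem 1 a < p.nameBound) :
    Runs E lookupCmd st (46 * (2 * p.leaves) + 30) fun st' => ∃ c,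
      Lookup (p.lookupName E.strB P) p.leaves p.nameBound (st.mem 1) c 1 ∧
      st'.reg 0 = if zeros c 1 p.h ≤ p.s * (p.l + 2) then 1 else 0 := by
  have hX := p.le_nameBound_of_n
  have hX' := p.two_mul_leaves_lt_nameBound
  have hM := p.leaves_pos
  have hh := p.two_pow_h_le_leaves
  have hl := p.l_lt_n
  have hkn := p.k_le_n
  have hsl : p.s * (p.l + 2) ≤ 2 * p.k := by
    have := p.s_mul_le
    have := p.two_mul_s_le
    nlinarith
  have hc {x : ℕ} (hx : x ≤ p.nameBound) : x % 2 ^ E.w = x := hE.mod_eq hx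
  have hone : 1 % 2 ^ E.w = 1 := hc (by omega)
  refine (Runs.cons <| .assign (2 * p.leaves) ?_ <| .cons <| .assign 0 (by simp) <|
    .cons (b' := 11) <| (Runs.loop (b := 42)
      (fun m st' => m + 1 ≤ 2 * p.leaves ∧ p.LookedUp E P (st.mem 1) (m + 1) st') ?_ ?_
      (2 * p.leaves - 1) ?_).imp ?_).of_le ?_
  · simpa [hr.reg_nine, hc (by omega : 2 ≤ _)] using hc hX'.le
  · rintro m st' ⟨hm, hI⟩
    exact ⟨by simp [hI.current, hone], (runs_lookupStep hE htab (by omega) (by omega) hI).imp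
      fun _ h => ⟨by omega, h⟩⟩
  · rintro st' ⟨-, hI⟩
    simp [hI.current, hone]
  · refine ⟨by omega, hr.congr fun r hr => ?_, ?_, by simpa using hP, by simp, ?_,
      ⟨fun i h₁ _ h₂ => ?_, fun i h₁ h₂ => ?_⟩⟩
    · simp [show r ≠ 12 by omega, show r ≠ 15 by omega]
    · simp; omega
    · rw [Finset.Ico_eq_empty (by omega)]; rfl
    all_goals omega
  · rintro st' ⟨-, hI⟩
    refine .cons <| .assign _ rfl <| .nil ⟨st'.mem 3, hI.lookup, ?_⟩
    simp [hI.ready.reg_six, hI.ready.reg_four, hI.count, zeros_root, hone, hc (by omega : 2 ≤ _),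
      hc (by omega : p.l + 2 ≤ _), hc (by omega : p.s * (p.l + 2) ≤ _),
      hc (by omega : p.s * (p.l + 2) + 1 ≤ _)]
  · simp [Expr.cost]
    omega

end Params

end GapEdit

namespace GapEdit

/-! ### Correctness of the answer -/

section Strings

variable {α : Type} {n σ s d q a b m : ℕ} {A B : Fin n → Fin σ}

theorem encode_le (A : Fin n → Fin σ) (i : ℕ) : encode A i ≤ σ := by
  unfold encode
  split_ifs
  · exact (A _).2
  · exact Nat.zero_le _

theorem encode_eq_elim (A : Fin n → Fin σ) (i : ℕ) :
    encode A i = (List.ofFn A)[i]?.elim 0 fun x => (x : ℕ) + 1 := by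
  unfold encode
  split_ifs with hi <;> simp [hi]

/-- The string `A` shifted by `d - s` agrees with `B` at position `q`. -/
abbrev Agrees (A B : Fin n → Fin σ) (s d q : ℕ) : Prop :=
  shiftSym s (encode A) d q = encode B q + 1

theorem ShiftedOn.agrees {δ : ℤ} (h : ShiftedOn (List.ofFn A) (List.ofFn B) δ a b) (hδ : |δ| ≤ s)
    (ha : a ≤ q) (hb : q < b) : Agrees A B s (s + δ).toNat q := by
  obtain ⟨hq, heq⟩ := h q ha hb
  rw [abs_le] at hδ
  rw [Agrees, shiftSym, if_neg (by omega), encode_eq_elim, encode_eq_elim, ← heq,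
    show q + ((s : ℤ) + δ).toNat - s = ((q : ℤ) + δ).toNat by omega]

/-- The positions in `[a, b)` where `A` shifted by `d - s` differs from `B`. -/
def mismatches (A B : Fin n → Fin σ) (s d a b : ℕ) : Finset ℕ :=
  (Finset.Ico a b).filter (¬Agrees A B s d ·)

/-- The periodic extension of a string. It makes `seg` applicable; its values at positions out of
range are irrelevant. -/
def periodic (hn : 0 < n) (A : Fin n → α) (i : ℕ) : α := A ⟨i % n, Nat.mod_lt i hn⟩

theorem periodic_of_lt (hn : 0 < n) (A : Fin n → α) {i : ℕ} (hi : i < n) :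
    periodic hn A i = A ⟨i, hi⟩ := by
  simp only [periodic, Nat.mod_eq_of_lt hi]

theorem seg_periodic (hn : 0 < n) (A : Fin n → α) : seg (periodic hn A) 0 n = List.ofFn A := by
  refine List.ext_getElem (by simp) fun i _ hi => ?_
  rw [List.length_ofFn] at hi
  simp [seg, periodic_of_lt hn A hi]

theorem Agrees.periodic_eq (hn : 0 < n) (h : Agrees A B s d q) (hs : s ≤ q + d)
    (hA : q + d - s < n) (hB : q < n) : periodic hn A (q + d - s) = periodic hn B q := by
  rw [Agrees, shiftSym, if_neg (by omega), encode, encode, dif_pos hA, dif_pos hB] at h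
  rw [periodic_of_lt hn A hA, periodic_of_lt hn B hB]
  exact Fin.ext (by omega)

theorem editsWithin_of_card_mismatches_le {k a' b' : ℕ} (hn : 0 < n) (hd : d ≤ 2 * s)
    (h : (mismatches A B s d a' b').card ≤ k) (ha : a' ≤ a ∨ m = 0) (hb : a + m ≤ b')
    (hmn : a + m ≤ n) :
    EditsWithin (k + 2 * s) (seg (periodic hn A) a m) (seg (periodic hn B) a m) := by
  refine (editsWithin_seg_of_shift (S := mismatches A B s d a' b') hd
    fun q hq hq' hs hs' hS => ?_).mono (by omega)
  have hagrees : Agrees A B s d q := by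
    by_contra hne
    exact hS (Finset.mem_filter.2 ⟨Finset.mem_Ico.2 ⟨by omega, by omega⟩, hne⟩)
  exact hagrees.periodic_eq hn hs (by omega) (by omega)

end Strings

namespace Params

variable {p : Params} {A B : Fin p.n → Fin p.σ} {P tape tab cur c : ℕ → ℕ} {cnt i R y : ℕ}

theorem samplePos_mem (hi : HasHeight (2 ^ p.h) R i) (hy : y ∈ descendants (R + p.t) i) :
    nodeStart p.h p.k R i ≤ p.samplePos tape (y - p.leaves) ∧
      p.samplePos tape (y - p.leaves) < nodeStart p.h p.k R (i + 1) := by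
  have hT : 0 < 2 ^ p.t := by positivity
  have hle := hi.le
  rw [mem_descendants, pow_add, ← mul_assoc, ← mul_assoc, ← Nat.le_div_iff_mul_le hT,
    ← Nat.div_lt_iff_lt_mul hT] at hy
  have hblock : (y - p.leaves) / 2 ^ p.t = y / 2 ^ p.t - 2 ^ p.h := by
    rw [leaves, mul_comm, Nat.sub_mul_div]
  rw [samplePos, hblock]
  exact ⟨(Nat.mul_le_mul_right _ (by omega)).trans (Nat.le_add_right _ _),
    mul_add_lt_mul (by omega) (Nat.mod_lt _ p.one_le_k)⟩

variable (p) in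
/-- The samples reveal every shift under which a node has more than `k` mismatches. -/
def Reveals (A B : Fin p.n → Fin p.σ) (tape : ℕ → ℕ) : Prop :=
  ∀ i R d, HasHeight (2 ^ p.h) R i → d < p.copies →
    (∀ y ∈ descendants (R + p.t) i, Agrees A B p.s d (p.samplePos tape (y - p.leaves))) →
    (mismatches A B p.s d (nodeStart p.h p.k R i) (nodeStart p.h p.k R (i + 1))).card ≤ p.k

theorem lookup_ne_zero_iff
    (hN : Naming (p.leafName (encode A) P) p.leaves p.copies p.nameBound tab cur cnt p.copies)
    (hL : Lookup (p.lookupName (encode B) P) p.leaves p.nameBound tab c 1)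
    (hi : HasHeight (2 ^ p.h) R i) :
    c i ≠ 0 ↔ ∃ d < p.copies, ∀ y ∈ descendants (R + p.t) i,
      Agrees A B p.s d (P (y - p.leaves)) := by
  obtain ⟨t, ht⟩ : ∃ t, p.t = t + 1 := Nat.exists_eq_succ_of_ne_zero fun h0 => by
    have := p.le_samples
    rw [h0] at this
    omega
  rw [ht, ← add_assoc]
  exact hN.lookup_ne_zero_iff hL p.copies_pos p.nodes_lt_nameBound (lookupName_lt (encode_le B))
    (by rw [add_assoc, ← ht]; exact hi.mul_two_pow p.t)

theorem zeros_le_of_editDist_le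
    (hN : Naming (p.leafName (encode A) (p.samplePos tape)) p.leaves p.copies p.nameBound tab cur
      cnt p.copies)
    (hL : Lookup (p.lookupName (encode B) (p.samplePos tape)) p.leaves p.nameBound tab c 1)
    (hed : editDist A B ≤ p.s) : zeros c 1 p.h ≤ p.s * (p.l + 2) := by
  obtain ⟨S, hS, hshift⟩ := (edits_editDist A B).exists_breakpoints
  have hzero (i R : ℕ) (hi : HasHeight (2 ^ p.h) R i) (hci : c i = 0) :
      ∃ x ∈ S, nodeStart p.h p.k R i ≤ x ∧ x < nodeStart p.h p.k R (i + 1) := by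
    by_contra! hcon
    obtain ⟨δ, hδ, hon⟩ := hshift _ _ fun x hx hx' hxS => (hcon x hxS hx).not_gt hx'
    have hδs : |δ| ≤ p.s := hδ.trans (by exact_mod_cast hed)
    refine (lookup_ne_zero_iff hN hL hi).2 ⟨(p.s + δ).toNat, ?_, fun y hy => ?_⟩ hci
    · rw [copies]
      have := (abs_le.1 hδs).2
      omega
    · obtain ⟨hle, hlt⟩ := samplePos_mem (tape := tape) hi hy
      exact hon.agrees hδs hle hlt
  calc zeros c 1 p.h ≤ (p.h + 1) * S.card := zeros_root_le S hzero
    _ ≤ (p.l + 2) * p.s := Nat.mul_le_mul (Nat.succ_le_succ p.h_le) (hS.trans hed)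
    _ = p.s * (p.l + 2) := mul_comm _ _

theorem editDist_le_of_zeros_le
    (hN : Naming (p.leafName (encode A) (p.samplePos tape)) p.leaves p.copies p.nameBound tab cur
      cnt p.copies)
    (hL : Lookup (p.lookupName (encode B) (p.samplePos tape)) p.leaves p.nameBound tab c 1)
    (hrev : p.Reveals A B tape) (hz : zeros c 1 p.h ≤ p.s * (p.l + 2)) :
    editDist A B ≤ 40 * p.k ^ 2 := by
  have hn : 0 < p.n := two_pos.trans_le p.two_le_n
  have hnode (i R a m : ℕ) (hi : HasHeight (2 ^ p.h) R i) (hci : c i ≠ 0)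
      (ha : a = min (nodeStart p.h p.k R i) p.n)
      (hm : a + m = min (nodeStart p.h p.k R (i + 1)) p.n) :
      EditsWithin (2 * p.k + 2 * p.s) (seg (periodic hn A) a m) (seg (periodic hn B) a m) := by
    obtain ⟨d, hd, hagree⟩ := (lookup_ne_zero_iff hN hL hi).1 hci
    exact (editsWithin_of_card_mismatches_le hn (Nat.lt_succ_iff.1 hd) (hrev i R d hi hd hagree)
      (by omega) (by omega) (by omega)).mono (by omega)
  have hroot := editsWithin_of_zeros (periodic hn A) (periodic hn B) (R := p.h) (i := 1) (a := 0)
    (m := p.n) (by omega) hnode ⟨by simp, by simp⟩ (by simp [nodeStart])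
    (by simpa [nodeStart, two_mul] using p.n_le_blocks)
  rw [seg_periodic, seg_periodic] at hroot
  have hs := p.s_mul_le
  have hs' := p.two_mul_s_le
  have hk := p.one_le_k
  have hzk : 2 * (p.s * (p.l + 2)) ≤ 3 * p.k := by nlinarith [p.one_le_l]
  calc editDist A B ≤ (zeros c 1 p.h + 1) * (2 * p.k + 2 * p.s) := editDist_le hroot
    _ ≤ (4 * p.k) * (3 * p.k) := Nat.mul_le_mul (by omega) (by omega)
    _ ≤ 40 * p.k ^ 2 := by nlinarith

end Params

end GapEdit

namespace GapEdit

open WordRAM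

/-! ### The samples reveal the mismatches with high probability -/

instance isProbabilityMeasure_tapeMeasure (w : ℕ) : IsProbabilityMeasure (tapeMeasure w) := by
  unfold tapeMeasure
  infer_instance

theorem sum_Ico_mul {M : Type*} [AddCommMonoid M] (f : ℕ → M) (T : ℕ) {u v : ℕ} (huv : u ≤ v) :
    ∑ j ∈ Finset.Ico (u * T) (v * T), f j =
      ∑ b ∈ Finset.Ico u v, ∑ r ∈ Finset.range T, f (b * T + r) := by
  induction v, huv using Nat.le_induction with
  | base => simp
  | succ v hv ih =>
    rw [← Finset.sum_Ico_consecutive _ (Nat.mul_le_mul_right T hv)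
      (Nat.mul_le_mul_right T v.le_succ), ih, Finset.sum_Ico_succ_top hv,
      Finset.sum_Ico_eq_sum_range f, Nat.succ_mul, Nat.add_sub_cancel_left]

section Uniform

variable {w k N : ℕ} {S : Finset ℕ}

theorem div_mul_card_le_card_mod_mem (hS : ∀ o ∈ S, o < k) :
    N / k * S.card ≤ ((Finset.range N).filter (· % k ∈ S)).card := by
  rw [← Finset.sum_card_fiberwise_eq_card_filter, mul_comm, ← smul_eq_mul]
  refine Finset.card_nsmul_le_sum _ _ _ fun o ho => ?_
  have hcount := Nat.count_modEq_card N (Nat.zero_lt_of_lt (hS o ho)) o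
  simp only [Nat.count_eq_card_filter_range, Nat.ModEq, Nat.mod_eq_of_lt (hS o ho)] at hcount
  exact (Nat.le_add_right ..).trans hcount.ge

theorem uniformOfFintype_toMeasure_val (P : ℕ → Prop) [DecidablePred P] [NeZero N] :
    (PMF.uniformOfFintype (Fin N)).toMeasure {x | P x} =
      ENNReal.ofReal (((Finset.range N).filter P).card / N) := by
  have hcard : (Finset.univ.filter fun x : Fin N => P x).card =
      ((Finset.range N).filter P).card := by
    rw [← Nat.Iio_eq_range, ← Fin.map_valEmbedding_univ, Finset.filter_map, Finset.card_map]
    rfl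
  rw [PMF.toMeasure_uniformOfFintype_apply _ (Set.toFinite _).measurableSet, Fintype.card_fin,
    Fintype.card_subtype, ENNReal.ofReal_div_of_pos (Nat.cast_pos.2 (NeZero.pos N)),
    ENNReal.ofReal_natCast, ENNReal.ofReal_natCast, ← hcard]
  rfl

theorem uniformOfFintype_mod_mem_ge (hkN : k ≤ N) [NeZero N] (hS : ∀ o ∈ S, o < k) :
    ENNReal.ofReal (S.card / (2 * k)) ≤
      (PMF.uniformOfFintype (Fin N)).toMeasure {x | (x : ℕ) % k ∈ S} := by
  obtain rfl | hk := Nat.eq_zero_or_pos k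
  · simp
  have hN : N ≤ 2 * k * (N / k) := by
    have := Nat.div_add_mod N k
    have := Nat.mod_lt N hk
    have := Nat.mul_le_mul_left k ((Nat.one_le_div_iff hk).2 hkN)
    linarith
  rw [uniformOfFintype_toMeasure_val (· % k ∈ S)]
  refine ENNReal.ofReal_le_ofReal ?_
  rw [div_le_div_iff₀ (by positivity) (Nat.cast_pos.2 (NeZero.pos N))]
  have hcard : S.card * N ≤ ((Finset.range N).filter (· % k ∈ S)).card * (2 * k) :=
    calc S.card * N ≤ S.card * (2 * k * (N / k)) := Nat.mul_le_mul_left _ hN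
      _ = N / k * S.card * (2 * k) := by ring
      _ ≤ _ := Nat.mul_le_mul_right _ (div_mul_card_le_card_mod_mem hS)
  exact_mod_cast hcard

theorem uniformOfFintype_mod_notMem_le (hkN : k ≤ N) [NeZero N] (hS : ∀ o ∈ S, o < k) :
    (PMF.uniformOfFintype (Fin N)).toMeasure {x | (x : ℕ) % k ∉ S} ≤
      ENNReal.ofReal (Real.exp (-(S.card / (2 * k)))) :=
  calc _ ≤ 1 - ENNReal.ofReal (S.card / (2 * k)) := prob_compl_le_one_sub_of_le_prob
        (uniformOfFintype_mod_mem_ge hkN hS) (Set.toFinite _).measurableSet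
    _ = ENNReal.ofReal (1 - S.card / (2 * k)) := by
      rw [ENNReal.ofReal_sub _ (by positivity), ENNReal.ofReal_one]
    _ ≤ _ := ENNReal.ofReal_le_ofReal (Real.one_sub_le_exp_neg _)

end Uniform

theorem HasHeight.height_le {h R i : ℕ} (hi : HasHeight (2 ^ h) R i) : R ≤ h := by
  have := hi.pos
  refine (Nat.pow_le_pow_iff_right one_lt_two).1 ?_
  have : 2 * 2 ^ R ≤ 2 * 2 ^ h := (Nat.mul_le_mul_right _ (by omega)).trans hi.lt
  omega

namespace Params

variable {p : Params} {A B : Fin p.n → Fin p.σ} {R i d : ℕ}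

theorem tapeMeasure_forall_samplePos_le (P : ℕ → Prop) [DecidablePred P] {u v : ℕ} (huv : u ≤ v)
    (hP : p.k ≤ ((Finset.Ico (u * p.k) (v * p.k)).filter P).card) :
    tapeMeasure p.w {ω | ∀ j ∈ Finset.Ico (u * 2 ^ p.t) (v * 2 ^ p.t),
      ¬P (p.samplePos (fun i => ω i) j)} ≤ ENNReal.ofReal (Real.exp (-(2 ^ p.t / 2))) := by
  have hk : (0 : ℝ) < p.k := Nat.cast_pos.2 p.one_le_k
  let hits (b : ℕ) : Finset ℕ := (Finset.range p.k).filter fun o => P (b * p.k + o)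
  have hevent : {ω : Tape p.w | ∀ j ∈ Finset.Ico (u * 2 ^ p.t) (v * 2 ^ p.t),
      ¬P (p.samplePos (fun i => ω i) j)} =
      Set.pi (Finset.Ico (u * 2 ^ p.t) (v * 2 ^ p.t))
        fun j => {x : Fin (2 ^ p.w) | (x : ℕ) % p.k ∉ hits (j / 2 ^ p.t)} := by
    ext ω
    simp [hits, samplePos, Nat.mod_lt _ p.one_le_k]
  have hhits : ∑ j ∈ Finset.Ico (u * 2 ^ p.t) (v * 2 ^ p.t), (hits (j / 2 ^ p.t)).card =
      ((Finset.Ico (u * p.k) (v * p.k)).filter P).card * 2 ^ p.t := by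
    have hdiv (b : ℕ) {r : ℕ} (hr : r ∈ Finset.range (2 ^ p.t)) :
        (b * 2 ^ p.t + r) / 2 ^ p.t = b := mul_add_div_of_lt (Finset.mem_range.1 hr)
    rw [sum_Ico_mul _ _ huv, Finset.card_filter, sum_Ico_mul _ _ huv, Finset.sum_mul]
    refine Finset.sum_congr rfl fun b _ => ?_
    rw [Finset.sum_congr rfl fun r hr => by rw [hdiv b hr], Finset.sum_const, Finset.card_range,
      smul_eq_mul, mul_comm, Finset.card_filter]
  rw [hevent, tapeMeasure, Measure.infinitePi_pi _ fun j _ => (Set.toFinite _).measurableSet]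
  refine (Finset.prod_le_prod' fun j _ => uniformOfFintype_mod_notMem_le p.k_le_two_pow_w
    fun o ho => Finset.mem_range.1 (Finset.mem_filter.1 ho).1).trans ?_
  rw [← ENNReal.ofReal_prod_of_nonneg (fun _ _ => (Real.exp_pos _).le), ← Real.exp_sum,
    Finset.sum_neg_distrib, ← Finset.sum_div, ← Nat.cast_sum, hhits]
  refine ENNReal.ofReal_le_ofReal (Real.exp_le_exp.2 (neg_le_neg ?_))
  rw [div_le_div_iff₀ two_pos (by positivity)]
  have := Nat.mul_le_mul_right (2 ^ p.t) hP
  exact_mod_cast (by linarith : 2 ^ p.t * (2 * p.k) ≤ _ * 2 ^ p.t * 2)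

theorem tapeMeasure_forall_agrees_le (hi : HasHeight (2 ^ p.h) R i)
    (hk : p.k ≤ (mismatches A B p.s d (nodeStart p.h p.k R i) (nodeStart p.h p.k R (i + 1))).card) :
    tapeMeasure p.w {ω | ∀ y ∈ descendants (R + p.t) i,
      Agrees A B p.s d (p.samplePos (fun i => ω i) (y - p.leaves))} ≤
      ENNReal.ofReal (Real.exp (-(2 ^ p.t / 2))) := by
  refine (measure_mono fun ω hω j hj => ?_).trans
    (tapeMeasure_forall_samplePos_le (¬Agrees A B p.s d ·)
      (Nat.sub_le_sub_right (Nat.mul_le_mul_right _ (by omega : i ≤ i + 1)) _) hk)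
  have hmem : j + p.leaves ∈ descendants (R + p.t) i := by
    have hle := hi.le
    have hle' : 2 ^ p.h ≤ (i + 1) * 2 ^ R := hle.trans (Nat.mul_le_mul_right _ i.le_succ)
    rw [Finset.mem_Ico, Nat.sub_mul, Nat.sub_mul] at hj
    have := Nat.mul_le_mul_right (2 ^ p.t) hle'
    rw [mem_descendants, pow_add, leaves, ← mul_assoc, ← mul_assoc]
    omega
  rw [not_not]
  simpa only [Nat.add_sub_cancel] using hω _ hmem

theorem card_mul_exp_le (p : Params) :
    ((2 * 2 ^ p.h * ((p.h + 1) * p.copies) : ℕ) : ℝ) * Real.exp (-(2 ^ p.t / 2)) ≤ 1 / p.n := by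
  have hn : (0 : ℝ) < p.n := Nat.cast_pos.2 (by have := p.two_le_n; omega)
  have hpow : 2 * 2 ^ p.h * ((p.h + 1) * p.copies) * p.n ≤ 2 ^ (8 * (p.l + 2)) :=
    calc 2 * 2 ^ p.h * ((p.h + 1) * p.copies) * p.n
        = 2 * (2 ^ p.h * p.copies) * (p.h + 1) * p.n := by ring
      _ ≤ 2 * (4 * 2 ^ (p.l + 1)) * 2 ^ (p.l + 2) * 2 ^ (p.l + 1) := by
        have := p.two_pow_h_mul_copies_le
        have hn := p.lt_two_pow_l.le
        have hh : p.h + 1 ≤ 2 ^ (p.l + 2) :=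
          (Nat.succ_le_succ p.h_le).trans (p.l + 2).lt_two_pow_self.le
        have hcopies : 2 ^ p.h * p.copies ≤ 4 * 2 ^ (p.l + 1) := by omega
        gcongr
      _ = 2 ^ (3 * p.l + 7) := by ring
      _ ≤ _ := Nat.pow_le_pow_right two_pos (by omega)
  have hexp : (2 : ℝ) ^ (8 * (p.l + 2)) ≤ Real.exp (2 ^ p.t / 2) := by
    have hle : ((16 * (p.l + 2) : ℕ) : ℝ) ≤ (2 ^ p.t : ℕ) := mod_cast p.le_samples
    calc (2 : ℝ) ^ (8 * (p.l + 2)) ≤ Real.exp 1 ^ (8 * (p.l + 2)) := by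
          have := Real.add_one_le_exp (1 : ℝ)
          gcongr
          linarith
      _ = Real.exp (8 * (p.l + 2) : ℕ) := by rw [← Real.exp_nat_mul, mul_one]
      _ ≤ _ := Real.exp_le_exp.2 (by push_cast at hle ⊢; linarith)
  rw [Real.exp_neg, ← div_eq_mul_inv, div_le_div_iff₀ (Real.exp_pos _) hn, one_mul]
  exact le_trans (mod_cast hpow) hexp

theorem tapeMeasure_not_reveals_le (A B : Fin p.n → Fin p.σ) :
    tapeMeasure p.w {ω | p.Reveals A B fun i => ω i}ᶜ ≤ ENNReal.ofReal (1 / p.n) := by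
  classical
  let heavy (x : ℕ × ℕ × ℕ) : Prop := HasHeight (2 ^ p.h) x.2.1 x.1 ∧ p.k < (mismatches A B p.s
    x.2.2 (nodeStart p.h p.k x.2.1 x.1) (nodeStart p.h p.k x.2.1 (x.1 + 1))).card
  let J := (Finset.range (2 * 2 ^ p.h) ×ˢ Finset.range (p.h + 1) ×ˢ
    Finset.range p.copies).filter heavy
  have hJ : J.card ≤ 2 * 2 ^ p.h * ((p.h + 1) * p.copies) :=
    (Finset.card_filter_le _ _).trans_eq (by simp)
  have hcover : {ω | p.Reveals A B fun i => ω i}ᶜ ⊆ ⋃ x ∈ J, {ω : Tape p.w |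
      ∀ y ∈ descendants (x.2.1 + p.t) x.1,
        Agrees A B p.s x.2.2 (p.samplePos (fun i => ω i) (y - p.leaves))} := by
    intro ω hω
    simp only [Set.mem_compl_iff, Set.mem_ofPred_eq, Reveals, not_forall, not_le] at hω
    obtain ⟨i, R, d, hi, hd, hagrees, hk⟩ := hω
    refine Set.mem_biUnion (x := (i, R, d)) (Finset.mem_filter.2 ⟨?_, hi, hk⟩) hagrees
    simp only [Finset.mem_product, Finset.mem_range]
    exact ⟨hi.lt_two_mul, Nat.lt_succ_of_le hi.height_le, hd⟩
  calc _ ≤ ∑ x ∈ J, ENNReal.ofReal (Real.exp (-(2 ^ p.t / 2))) :=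
        (measure_mono hcover).trans <| (measure_biUnion_finset_le J _).trans <|
          Finset.sum_le_sum fun x hx =>
            have hheavy := (Finset.mem_filter.1 hx).2
            tapeMeasure_forall_agrees_le hheavy.1 hheavy.2.le
    _ = ENNReal.ofReal (J.card * Real.exp (-(2 ^ p.t / 2))) := by
      rw [Finset.sum_const, nsmul_eq_mul, ENNReal.ofReal_mul (by positivity),
        ENNReal.ofReal_natCast]
    _ ≤ _ := ENNReal.ofReal_le_ofReal <| le_trans (by gcongr) p.card_mul_exp_le

theorem tapeMeasure_reveals_ge (A B : Fin p.n → Fin p.σ) :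
    ENNReal.ofReal (1 - 1 / p.n) ≤ tapeMeasure p.w {ω | p.Reveals A B fun i => ω i} := by
  rw [ENNReal.ofReal_sub _ (by positivity), ENNReal.ofReal_one, tsub_le_iff_right,
    ← measure_univ (μ := tapeMeasure p.w)]
  exact (measure_univ_le_add_compl _).trans
    (add_le_add_right (tapeMeasure_not_reveals_le A B) _)

end Params

end GapEdit

namespace GapEdit

open WordRAM

/-! ### Preprocessing and query -/

/-- The program that preprocesses the first string. -/
def preCmd : Cmd := block [setupCmd, sampleCmd, nameCmd]

/-- The program that compares the second string with the preprocessed first string. -/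
def queryCmd : Cmd := block [setupCmd, lookupCmd]

theorem randFree_queryCmd : queryCmd.RandFree := by
  simp [queryCmd, setupCmd, lookupCmd, lookupStep, lookupNode, doubleCmd, block, Cmd.RandFree]

namespace Params

variable {p : Params}

/-- The memory `m` that the preprocessing of the string `A` leaves: the sample positions, and the
dictionary of the names of the nodes. -/
structure Prepared (p : Params) (A : Fin p.n → Fin p.σ) (tape : ℕ → ℕ) (m : ℕ → ℕ → ℕ) :
    Prop where
  samples : ∀ j < p.leaves, m 0 j = p.samplePos tape j
  naming : ∃ cnt, Naming (p.leafName (encode A) (p.samplePos tape)) p.leaves p.copies p.nameBound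
    (m 1) (m 2) cnt p.copies

theorem isEnv_preEnv (A : Fin p.n → Fin p.σ) (ω : Tape p.w) : p.IsEnv (preEnv p.w A ω) :=
  ⟨rfl, encode_le A, fun _ => Nat.zero_le _⟩

theorem isEnv_queryEnv (A B : Fin p.n → Fin p.σ) : p.IsEnv (queryEnv p.w A B) :=
  ⟨rfl, encode_le A, encode_le B⟩

theorem runs_preCmd (A : Fin p.n → Fin p.σ) (ω : Tape p.w) :
    Runs (preEnv p.w A ω) preCmd (preInit p.w p.n p.k p.σ) (100000 * (p.n * p.l))
      fun st => p.Prepared A (fun i => ω i) st.mem := by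
  have hE := isEnv_preEnv A ω
  have hnodes : 2 * p.leaves * p.copies ≤ 768 * (p.n * p.l) :=
    calc 2 * p.leaves * p.copies = 2 * (2 ^ p.h * p.copies) * 2 ^ p.t := by rw [leaves]; ring
      _ ≤ 2 * (4 * p.n) * (96 * p.l) := Nat.mul_le_mul
        (Nat.mul_le_mul_left _ p.two_pow_h_mul_copies_le) p.samples_le_mul_l
      _ = _ := by ring
  refine (Runs.cons (runs_setupCmd hE rfl rfl rfl |>.imp ?_)).of_le
    (b := 1700 * p.l + (30 * p.leaves + 10 + (63 * (2 * p.leaves * p.copies) + 20 + 1))) ?_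
  · rintro st ⟨hr, hmem, hpos⟩
    refine Runs.cons (runs_sampleCmd hE hr hpos (congrFun hmem 1) |>.imp fun st hS => ?_)
    exact .cons <| (runs_nameCmd hE (fun j => samplePos_lt _) hS.ready hS.samples
      hS.dict_empty).imp fun st hN => .nil ⟨hN.samples, _, hN.naming⟩
  · have := Nat.le_mul_of_pos_right (2 * p.leaves) p.copies_pos
    have := p.one_le_l
    have := Nat.le_mul_of_pos_left p.l (zero_lt_two.trans_le p.two_le_n)
    omega

theorem runs_queryCmd (A B : Fin p.n → Fin p.σ) {tape : ℕ → ℕ} {st : State}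
    (hst : p.Prepared A tape st.mem) :
    Runs (queryEnv p.w A B) queryCmd (queryInit p.w p.n p.k p.σ st) (20000 * (2 ^ p.h * p.l))
      fun st' => (editDist A B ≤ p.s → st'.reg 0 = 1) ∧
        (p.Reveals A B tape → 40 * p.k ^ 2 < editDist A B → st'.reg 0 = 0) := by
  have hE := isEnv_queryEnv A B
  obtain ⟨cnt, hN⟩ := hst.naming
  refine (Runs.cons (runs_setupCmd hE rfl rfl rfl |>.imp ?_)).of_le
    (b := 1700 * p.l + (46 * (2 * p.leaves) + 30 + 1)) ?_
  · rintro st₁ ⟨hr, hmem, -⟩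
    replace hmem : st₁.mem = st.mem := hmem
    refine .cons <| (runs_lookupCmd hE hr (P := p.samplePos tape) (by rw [hmem]; exact hst.samples)
      (by rw [hmem]; exact hN.tab_lt p.nodes_lt_nameBound)).imp ?_
    rintro st₂ ⟨c, hL, hanswer⟩
    rw [hmem] at hL
    refine .nil ⟨fun hed => ?_, fun hrev hed => ?_⟩
    · rw [hanswer, if_pos (zeros_le_of_editDist_le hN hL hed)]
    · rw [hanswer, if_neg fun hz => hed.not_ge (editDist_le_of_zeros_le hN hL hrev hz)]
  · have hleaves : p.leaves ≤ 96 * (2 ^ p.h * p.l) :=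
      (Nat.mul_le_mul_left _ p.samples_le_mul_l).trans_eq (by ring)
    have := p.one_le_l
    have := Nat.le_mul_of_pos_left p.l (Nat.two_pow_pos p.h)
    omega

theorem l_le_logb (p : Params) : (p.l : ℝ) ≤ Real.logb 2 p.n := by
  rw [Real.le_logb_iff_rpow_le one_lt_two (Nat.cast_pos.2 (zero_lt_two.trans_le p.two_le_n)),
    Real.rpow_natCast]
  exact_mod_cast p.two_pow_l_le

theorem le_s_of_le {e : ℕ} (he : (e : ℝ) ≤ p.k / (2 * Real.logb 2 p.n)) : e ≤ p.s := by
  have hl : (1 : ℝ) ≤ p.l := Nat.one_le_cast.2 p.one_le_l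
  have hlog := p.l_le_logb
  rw [le_div_iff₀ (by linarith)] at he
  have hmul : (e : ℝ) * (2 * p.l) ≤ p.k := le_trans (by gcongr) he
  rw [s, Nat.le_div_iff_mul_le (by have := p.one_le_l; omega)]
  exact_mod_cast hmul

theorem lintegral_runtime_preCmd_le (A : Fin p.n → Fin p.σ) :
    ∫⁻ ω, runtime (preEnv p.w A ω) preCmd (preInit p.w p.n p.k p.σ) ∂tapeMeasure p.w ≤
      ENNReal.ofReal ((100000 : ℕ) * p.n * Real.logb 2 p.n ^ 1) :=
  calc _ ≤ ∫⁻ _, ((100000 * (p.n * p.l) : ℕ) : ℝ≥0∞) ∂tapeMeasure p.w :=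
        lintegral_mono fun ω => (runs_preCmd A ω).runtime_le
    _ = ENNReal.ofReal (100000 * (p.n * p.l) : ℕ) := by
      rw [lintegral_const, measure_univ, mul_one, ENNReal.ofReal_natCast]
    _ ≤ _ := ENNReal.ofReal_le_ofReal <| by
      push_cast
      rw [pow_one, mul_assoc]
      gcongr
      exact p.l_le_logb

theorem exists_exec_queryCmd (A B : Fin p.n → Fin p.σ) (ω : Tape p.w) {st : State} {t : ℕ}
    (hpre : Exec (preEnv p.w A ω) preCmd (preInit p.w p.n p.k p.σ) st t) :
    ∃ st' t', Exec (queryEnv p.w A B) queryCmd (queryInit p.w p.n p.k p.σ st) st' t' ∧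
      (t' : ℝ) ≤ (100000 : ℕ) * (p.n / p.k) * Real.logb 2 p.n ^ 1 := by
  have hprep := (runs_preCmd A ω).post_of_exec hpre
  obtain ⟨st', t', hexec, ht', -⟩ := runs_queryCmd A B hprep
  have hblocks : (2 : ℝ) ^ p.h ≤ 2 * (p.n / p.k) := by
    rw [← mul_div_assoc, le_div_iff₀ (Nat.cast_pos.2 p.one_le_k)]
    exact_mod_cast p.blocks_le
  have hlog := p.l_le_logb
  have hlog_nonneg : 0 ≤ Real.logb 2 p.n := (Nat.cast_nonneg _).trans hlog
  refine ⟨st', t', hexec, ?_⟩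
  calc (t' : ℝ) ≤ 20000 * (2 ^ p.h * p.l) := mod_cast ht'
    _ ≤ 20000 * (2 * (p.n / p.k) * Real.logb 2 p.n) := by gcongr
    _ = 40000 * (p.n / p.k) * Real.logb 2 p.n ^ 1 := by ring
    _ ≤ _ := by gcongr; norm_num

theorem tapeMeasure_correct_ge (A B : Fin p.n → Fin p.σ) :
    ENNReal.ofReal (1 - 1 / p.n) ≤ tapeMeasure p.w {ω | ∃ st st' t t',
      Exec (preEnv p.w A ω) preCmd (preInit p.w p.n p.k p.σ) st t ∧
      Exec (queryEnv p.w A B) queryCmd (queryInit p.w p.n p.k p.σ st) st' t' ∧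
      Correct p.k A B st'} := by
  refine (tapeMeasure_reveals_ge A B).trans (measure_mono fun ω hω => ?_)
  obtain ⟨st, t, hpre, -, hprep⟩ := runs_preCmd A ω
  obtain ⟨st', t', hquery, -, hsmall, hlarge⟩ := runs_queryCmd A B hprep
  exact ⟨st, st', t, t', hpre, hquery, fun h => hsmall (le_s_of_le h),
    fun h => hlarge hω (mod_cast h)⟩

end Params

end GapEdit

theorem mainTheorem2 :
    ∃ (pre query : WordRAM.Cmd) (c₀ C c : ℕ), 1 ≤ c₀ ∧ query.RandFree ∧
      ∀ (σ n k : ℕ), 2 ≤ n → 1 ≤ k → k ≤ n →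
        -- the preprocessing of `A` takes expected time `Õ(n)`
        (∀ A : Fin n → Fin σ,
          ∫⁻ ω, WordRAM.runtime (GapEdit.preEnv (GapEdit.wordSize c₀ n σ) A ω) pre
              (GapEdit.preInit (GapEdit.wordSize c₀ n σ) n k σ)
              ∂(WordRAM.tapeMeasure (GapEdit.wordSize c₀ n σ))
            ≤ ENNReal.ofReal (C * n * Real.logb 2 n ^ c)) ∧
        -- whatever the preprocessing has left, every query halts in time `Õ(n / k)`
        (∀ (A B : Fin n → Fin σ) (ω : WordRAM.Tape (GapEdit.wordSize c₀ n σ))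
            (s : WordRAM.State) (t : ℕ),
          WordRAM.Exec (GapEdit.preEnv (GapEdit.wordSize c₀ n σ) A ω) pre
              (GapEdit.preInit (GapEdit.wordSize c₀ n σ) n k σ) s t →
          ∃ (s' : WordRAM.State) (t' : ℕ),
            WordRAM.Exec (GapEdit.queryEnv (GapEdit.wordSize c₀ n σ) A B) query
              (GapEdit.queryInit (GapEdit.wordSize c₀ n σ) n k σ s) s' t' ∧
            (t' : ℝ) ≤ C * ((n : ℝ) / k) * Real.logb 2 n ^ c) ∧
        -- for every `B`, the answer is correct with probability at least `1 - 1 / n` over the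
        -- random words that are drawn in the preprocessing
        (∀ A B : Fin n → Fin σ,
          ENNReal.ofReal (1 - 1 / n) ≤
            WordRAM.tapeMeasure (GapEdit.wordSize c₀ n σ)
              {ω | ∃ (s s' : WordRAM.State) (t t' : ℕ),
                WordRAM.Exec (GapEdit.preEnv (GapEdit.wordSize c₀ n σ) A ω) pre
                  (GapEdit.preInit (GapEdit.wordSize c₀ n σ) n k σ) s t ∧
                WordRAM.Exec (GapEdit.queryEnv (GapEdit.wordSize c₀ n σ) A B) query
                  (GapEdit.queryInit (GapEdit.wordSize c₀ n σ) n k σ s) s' t' ∧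
                GapEdit.Correct k A B s'}) := by
  refine ⟨GapEdit.preCmd, GapEdit.queryCmd, 20, 100000, 1, by norm_num,
    GapEdit.randFree_queryCmd, fun σ n k hn hk hkn => ?_⟩
  let p : GapEdit.Params := ⟨n, k, σ, hn, hk, hkn⟩
  exact ⟨p.lintegral_runtime_preCmd_le, fun A B ω _ _ => p.exists_exec_queryCmd A B ω,
    p.tapeMeasure_correct_ge⟩
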